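/- Let $d\ge 3$, let $n_1,\dots,n_d\ge 2$ and $s_1,\dots,s_{d-1}\ge 1$ be integers, put $s_0=s_d=1$, and assume $s_{i-1}s_i\le n_i$ for all $1\le i\le d$ (that is, $s_1\le n_1$, $s_{i-1}s_i\le n_i$ for $2\le i\le d-1$, and $s_{d-1}\le n_d$). The TT rank of $T\in\mathbb R^{n_1}\otimes\dots\otimes\mathbb R^{n_d}$ is the tuple of the ranks of $T$ as maps $\mathbb R^{n_1}\otimes\dots\otimes\mathbb R^{n_j}\to\mathbb R^{n_{j+1}}\otimes\dots\otimes\mathbb R^{n_d}$, $1\le j\le d-1$; the multilinear rank of $T$ is the tuple of the ranks of $T$ as maps $\mathbb R^{n_i}\to\bigotimes_{k\ne i}\mathbb R^{n_k}$, $1\le i\le d$. Let $G=\mathrm{GL}(n_1)\times\dots\times\mathrm{GL}(n_d)$ (real general linear groups) act by $(g_1,\dots,g_d)\cdot(v_1\otimes\dots\otimes v_d)=g_1v_1\otimes\dots\otimes g_dv_d$. Let $S$ be the set of tensors of TT rank $(s_1,\dots,s_{d-1})$, and let $\Pi\subseteq S$ be the subset of tensors of multilinear rank $(s_0s_1,s_1s_2,\dots,s_{d-1}s_d)=(s_1,s_1s_2,\dots,s_{d-1})$.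 Let $T_0$ be the tensor $$(T_0)_{k_1\dots k_d}=\sum_{\alpha_1,\dots,\alpha_{d-1}}(E_1)_{k_1\alpha_1}(E_2)^{\alpha_1}{}_{k_2\alpha_2}\cdots(E_d)^{\alpha_{d-1}}{}_{k_d},$$ where the unfolding of $E_i$ is the $n_i\times s_{i-1}s_i$ matrix with ones on the main diagonal and zeros elsewhere, the pairs $(\alpha_{i-1},\alpha_i)$ being ordered lexicographically. Then: 1. $S$ is invariant under $G$, and every tensor in $S$ has multilinear rank at most $(s_1,s_1s_2,\dots,s_{d-1})$ componentwise. 2. $\Pi$ is the $G$-orbit of $T_0$ (in particular, it is non-empty, so that the bound in 1 is attained). It is open and dense in $S$ in the Euclidean topology, and it is Zariski open in the Zariski closure of $S$. 3. Let $H$ be the stabilizer of $T_0$ in $G$. Then $\Pi$ is the smooth homogeneous manifold $G/H$. That is, $G/H$ with the quotient topology and $\Pi$ with the subspace topology carry smooth manifold structures such that the projection $\pi:G\to G/H$ is a smooth submersion, a function $f:G/H\to\mathbb R$ is smooth if and only if $f\circ\pi$ is smooth, the transitive action of $G$ on $\Pi$ is smooth, and $gH\mapsto g\cdot T_0$ is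 a diffeomorphism from $G/H$ onto $\Pi$. 4. $H$ consists exactly of the tuples $(g_1,\dots,g_d)\in G$ with $$g_i=\begin{bmatrix}A_{i-1}^{-\mathsf T}\otimes A_i & M_i\\ 0& B_i\end{bmatrix},\qquad 1\le i\le d,$$ where $A_j\in\mathrm{GL}(s_j)$ for $0\le j\le d$ with $A_0=1$ and $A_d=1$, $B_i\in\mathrm{GL}(n_i-s_{i-1}s_i)$, and $M_i$ is an arbitrary real $s_{i-1}s_i\times(n_i-s_{i-1}s_i)$ matrix. (So the upper left block is $A_1$ for $i=1$ and $A_{d-1}^{-\mathsf T}$ for $i=d$.) -/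

import Mathlib

open scoped Manifold ContDiff Kronecker

namespace TensorTrain

variable {d : ℕ}

/-- Real tensors of format `n 0 × ⋯ × n (d - 1)`, i.e. elements of
`ℝ^{n_1} ⊗ ⋯ ⊗ ℝ^{n_d}` in the standard bases. -/
abbrev Tensor (n : Fin d → ℕ) : Type := (∀ i, Fin (n i)) → ℝ

/-- The product of the real matrix algebras of sizes `n_i × n_i`. -/
def MatProd (n : Fin d → ℕ) : Type := ∀ i, Matrix (Fin (n i)) (Fin (n i)) ℝ

section

-- `MatProd n` as a finite-dimensional normed algebra. The choice of norm is immaterial: it only serves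
-- to make the group of units a Lie group, as an open subset of the matrix algebra.
attribute [local instance] Matrix.linftyOpNormedRing Matrix.linftyOpNormedAlgebra

noncomputable instance (n : Fin d → ℕ) : NormedRing (MatProd n) :=
  inferInstanceAs (NormedRing (∀ i, Matrix (Fin (n i)) (Fin (n i)) ℝ))

noncomputable instance (n : Fin d → ℕ) : NormedAlgebra ℝ (MatProd n) :=
  inferInstanceAs (NormedAlgebra ℝ (∀ i, Matrix (Fin (n i)) (Fin (n i)) ℝ))

instance (n : Fin d → ℕ) : CompleteSpace (MatProd n) :=
  inferInstanceAs (CompleteSpace (∀ i, Matrix (Fin (n i)) (Fin (n i)) ℝ))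

end

/-- The Lie group `GL(n_1) × ⋯ × GL(n_d)`, as the group of units of the product of the matrix
algebras. -/
abbrev GLProd (n : Fin d → ℕ) : Type := (MatProd n)ˣ

/-- `GLProd n` is the product of the groups `GL(n_i)`. -/
def glProdEquiv (n : Fin d → ℕ) : GLProd n ≃* ∀ i, GL (Fin (n i)) ℝ :=
  MulEquiv.piUnits (M := fun i => Matrix (Fin (n i)) (Fin (n i)) ℝ)

/-- The pure tensor `v_1 ⊗ ⋯ ⊗ v_d`. -/
def pureTensor {n : Fin d → ℕ} (v : ∀ i, Fin (n i) → ℝ) : Tensor n := fun k => ∏ i, v i (k i)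

/-- The action of `GL(n_1) × ⋯ × GL(n_d)` on tensors:
`(g · T)_k = ∑_l (∏_i (g_i)_{k_i l_i}) T_l`. -/
noncomputable instance glAction (n : Fin d → ℕ) : MulAction (GLProd n) (Tensor n) where
  smul g T := fun k => ∑ l : ∀ i, Fin (n i), (∏ i, g.val i (k i) (l i)) * T l
  one_smul T := by
    funext k
    change ∑ l : ∀ i, Fin (n i), (∏ i, (1 : Matrix (Fin (n i)) (Fin (n i)) ℝ) (k i) (l i)) * T l
      = T k
    rw [Finset.sum_eq_single k]
    · simp
    · intro l _ hl
      obtain ⟨i, hi⟩ := Function.ne_iff.mp hl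
      rw [Finset.prod_eq_zero (Finset.mem_univ i), zero_mul]
      exact Matrix.one_apply_ne (Ne.symm hi)
    · simp
  mul_smul g h T := by
    funext k
    change ∑ l : ∀ i, Fin (n i), (∏ i, (g.val i * h.val i) (k i) (l i)) * T l
      = ∑ m : ∀ i, Fin (n i), (∏ i, g.val i (k i) (m i)) *
          ∑ l : ∀ i, Fin (n i), (∏ i, h.val i (m i) (l i)) * T l
    simp only [Matrix.mul_apply, Finset.prod_univ_sum, Finset.mul_sum, Finset.sum_mul,
      Fintype.piFinset_univ, Finset.prod_mul_distrib]
    rw [Finset.sum_comm]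
    simp only [mul_assoc]

/-- On pure tensors the action is `g · (v_1 ⊗ ⋯ ⊗ v_d) = (g_1 v_1) ⊗ ⋯ ⊗ (g_d v_d)`. -/
theorem smul_pureTensor {n : Fin d → ℕ} (g : GLProd n) (v : ∀ i, Fin (n i) → ℝ) :
    g • pureTensor v = pureTensor fun i => (g.val i).mulVec (v i) := by
  funext k
  change ∑ l : ∀ i, Fin (n i), (∏ i, g.val i (k i) (l i)) * ∏ i, v i (l i)
    = ∏ i, ∑ l, g.val i (k i) l * v i l
  simp only [Finset.prod_univ_sum, Fintype.piFinset_univ, Finset.prod_mul_distrib]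

/-- The flattening of a tensor as the matrix of the linear map
`⨂_{p i} ℝ^{n_i} → ⨂_{¬ p i} ℝ^{n_i}`, for a set `p` of modes. -/
def flattening {n : Fin d → ℕ} (p : Fin d → Prop) [DecidablePred p] (T : Tensor n) :
    Matrix (∀ i : {i // ¬ p i}, Fin (n i)) (∀ i : {i // p i}, Fin (n i)) ℝ :=
  Matrix.of fun b a => T ((Equiv.piEquivPiSubtypeProd p fun i => Fin (n i)).symm (a, b))

/-- The `j`-th TT rank: the rank of `T` as a map from the tensor product of the first `j` factors to
the tensor product of the remaining ones. -/
noncomputable def ttRank {n : Fin d → ℕ} (T : Tensor n) (j : Fin (d + 1)) : ℕ :=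
  (flattening (fun i : Fin d => i.val < j.val) T).rank

/-- The multilinear rank in mode `i`: the rank of `T` as a map from the `i`-th factor to the tensor
product of the other ones. -/
noncomputable def multilinearRank {n : Fin d → ℕ} (T : Tensor n) (i : Fin d) : ℕ :=
  (flattening (fun k : Fin d => k = i) T).rank

/-- The set of tensors of TT rank `(s_1, …, s_{d-1})`; the boundary values `s_0`, `s_d` of `s` play
no role here. -/
def ttRankSet (n : Fin d → ℕ) (s : Fin (d + 1) → ℕ) : Set (Tensor n) :=
  {T | ∀ j, j ≠ 0 → j ≠ Fin.last d → ttRank T j = s j}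

/-- The set `Π` of tensors of TT rank `(s_1, …, s_{d-1})` and multilinear rank
`(s_0 s_1, s_1 s_2, …, s_{d-1} s_d)`. -/
def ttManifold (n : Fin d → ℕ) (s : Fin (d + 1) → ℕ) : Set (Tensor n) :=
  {T | T ∈ ttRankSet n s ∧ ∀ i : Fin d, multilinearRank T i = s i.castSucc * s i.succ}

/-- The tensor `T_k = ∑_α ∏_i (F_i)_{α_{i-1} k_i α_i}` with TT cores `F_1, …, F_d`. -/
def ofCores {n : Fin d → ℕ} {s : Fin (d + 1) → ℕ}
    (F : ∀ i : Fin d, Fin (s i.castSucc) → Fin (n i) → Fin (s i.succ) → ℝ) : Tensor n :=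
  fun k => ∑ α : ∀ j, Fin (s j), ∏ i : Fin d, F i (α i.castSucc) (k i) (α i.succ)

/-- Splitting of `{0, …, n - 1}` into an initial segment of length `a * b`, indexed by pairs in
lexicographic order, and the rest. -/
def blockEquiv {a b n : ℕ} (h : a * b ≤ n) : (Fin a × Fin b) ⊕ Fin (n - a * b) ≃ Fin n :=
  ((finProdFinEquiv.sumCongr (Equiv.refl _)).trans finSumFinEquiv).trans
    (finCongr (Nat.add_sub_of_le h))

/-- The base point: the tensor whose `i`-th TT core has as its unfolding the
`n_i × s_{i-1} s_i` identity matrix (ones on the main diagonal and zeros elsewhere). -/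
def baseTensor {n : Fin d → ℕ} {s : Fin (d + 1) → ℕ}
    (h : ∀ i : Fin d, s i.castSucc * s i.succ ≤ n i) : Tensor n :=
  ofCores (s := s) fun i a k b => if k = blockEquiv (h i) (Sum.inl (a, b)) then 1 else 0

/-- The tuples of matrices whose `i`-th component is the block matrix
`[A_{i-1}^{-T} ⊗ A_i, M_i; 0, B_i]` with `A_i`, `B_i` invertible, `A_0 = 1`, `A_d = 1`. -/
def IsStabilizerForm {n : Fin d → ℕ} {s : Fin (d + 1) → ℕ}
    (h : ∀ i : Fin d, s i.castSucc * s i.succ ≤ n i)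
    (g : MatProd n) : Prop :=
  ∃ (A : ∀ j, GL (Fin (s j)) ℝ)
    (B : ∀ i : Fin d, GL (Fin (n i - s i.castSucc * s i.succ)) ℝ)
    (M : ∀ i : Fin d, Matrix (Fin (s i.castSucc) × Fin (s i.succ))
      (Fin (n i - s i.castSucc * s i.succ)) ℝ),
    A 0 = 1 ∧ A (Fin.last d) = 1 ∧
    ∀ i : Fin d, g i = Matrix.reindex (blockEquiv (h i)) (blockEquiv (h i))
      (Matrix.fromBlocks
        (((A i.castSucc)⁻¹).val.transpose ⊗ₖ (A i.succ).val) (M i)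
        0 (B i).val)

/-- `U` is a Zariski open subset of the Zariski closure of `S`. -/
def IsZariskiOpenInClosure {σ : Type} (S U : Set (σ → ℝ)) : Prop :=
  ∃ I : Ideal (MvPolynomial σ ℝ),
    U = MvPolynomial.zeroLocus ℝ (MvPolynomial.vanishingIdeal ℝ S) \ MvPolynomial.zeroLocus ℝ I

/-- The orbit of `T`, with the subspace topology, is the smooth homogeneous manifold `G / H`, where
`H` is the stabilizer of `T`: the quotient `G / H` and the orbit carry smooth manifold structures such
that
* the projection `π : G → G / H` is a smooth submersion, and a function `f` on `G / H` is smooth if and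
  only if `f ∘ π` is smooth;
* `G` acts smoothly on the orbit;
* `g H ↦ g · T` is a diffeomorphism from `G / H` to the orbit. -/
def OrbitIsSmoothHomogeneous {n : Fin d → ℕ} (T : Tensor n) : Prop :=
  ∃ (k : ℕ)
    (_ : ChartedSpace (EuclideanSpace ℝ (Fin k)) (GLProd n ⧸ MulAction.stabilizer (GLProd n) T))
    (_ : ChartedSpace (EuclideanSpace ℝ (Fin k)) (MulAction.orbit (GLProd n) T)),
    IsManifold (𝓡 k) ∞ (GLProd n ⧸ MulAction.stabilizer (GLProd n) T) ∧
    IsManifold (𝓡 k) ∞ (MulAction.orbit (GLProd n) T) ∧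
    ContMDiff 𝓘(ℝ, MatProd n) (𝓡 k) ∞
      (fun g : GLProd n => (g : GLProd n ⧸ MulAction.stabilizer (GLProd n) T)) ∧
    (∀ g : GLProd n, Function.Surjective
      (mfderiv 𝓘(ℝ, MatProd n) (𝓡 k)
        (fun g : GLProd n => (g : GLProd n ⧸ MulAction.stabilizer (GLProd n) T)) g)) ∧
    (∀ f : (GLProd n ⧸ MulAction.stabilizer (GLProd n) T) → ℝ,
      ContMDiff (𝓡 k) 𝓘(ℝ, ℝ) ∞ f ↔
      ContMDiff 𝓘(ℝ, MatProd n) 𝓘(ℝ, ℝ) ∞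
        (fun g : GLProd n => f (g : GLProd n ⧸ MulAction.stabilizer (GLProd n) T))) ∧
    ContMDiff (𝓘(ℝ, MatProd n).prod (𝓡 k)) (𝓡 k) ∞
      (fun q : GLProd n × MulAction.orbit (GLProd n) T => q.1 • q.2) ∧
    ∃ Φ : (GLProd n ⧸ MulAction.stabilizer (GLProd n) T) ≃ₘ^∞⟮𝓡 k, 𝓡 k⟯
        (MulAction.orbit (GLProd n) T),
      ∀ g : GLProd n,
        (Φ (g : GLProd n ⧸ MulAction.stabilizer (GLProd n) T) : Tensor n) = g • T

end TensorTrain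

/-!
A tensor train `T_k = ∑_α ∏_i (F_i)_{α_{i-1} k_i α_i}` is obtained from the base tensor by letting the
tuple of matrices whose leading columns are the fibres of the cores `F_i` act on it
(`matAct_baseTensor`), and every tensor of TT rank `s` is a tensor train with bond dimensions `s`
(`exists_ofCores`). Hence the set of tensors of TT rank `s` lies in the image of the base tensor under
tuples of not necessarily invertible matrices. As such tuples do not increase ranks of flattenings,
the multilinear rank is bounded by that of the base tensor; as invertible tuples are dense, the orbit
is dense. If the multilinear rank is maximal, then the unfoldings of the cores have full column rank
and are the leading columns of invertible matrices, so the tensor lies in the orbit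
(`ttManifold_eq_orbit`). Openness, in both topologies, holds because lower bounds on ranks are
expressed by minors that do not vanish.

TT decompositions are obtained from crosses: at each bond, choose rows and columns of the flattening
that meet in an invertible matrix of the size of the rank. By the skeleton decomposition of matrices,
the cores are then rational functions of the entries of `T` in these rows and columns
(`ofCores_crossCores`). For the base tensor there are crosses in which the flattenings restrict to
identity matrices (`baseTensor_mix_crossIndex`). This has two consequences.

The cores defined by `g` in the stabilizer, contracted to the left and to the right of each bond and
evaluated on these crosses, give mutually inverse matrices, which are the gauge transformations `A_j`
that describe `g` (`isStabilizerForm_of_smul_baseTensor`).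

Also, the decomposition with these fixed crosses is a smooth local section of the orbit map, defined
on an open set of tensors (`exists_smooth_section`). It makes the orbit a smooth retract of an open
set, so the inverse function theorem provides charts (`exists_isCompatibleChart_of_retraction`) which
are restrictions of linear maps and whose inverses are smooth maps to the space of tensors. It also
shows that `G / H` is embedded in the space of tensors (`isInducing_ofQuotientStabilizer`), so the same
construction yields charts of `G / H`. Smoothness of maps into either manifold can then be tested in
the space of tensors, and smoothness of maps out of `G / H` with local sections.
-/

namespace TensorTrain

section

/-! ### Ranks and minors -/

section Rank

variable {m n : Type*} [Fintype n]

/-- A nonvanishing minor bounds the rank from below. -/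
theorem card_le_rank_of_det_submatrix_ne_zero {ι : Type*} [Fintype ι] [DecidableEq ι]
    (A : Matrix m n ℝ) (f : ι → m) (g : ι → n) (h : (A.submatrix f g).det ≠ 0) :
    Fintype.card ι ≤ A.rank := by
  have h1 := Matrix.rank_submatrix_le A f g
  rwa [Matrix.rank_of_det_ne_zero h] at h1

theorem le_rank_of_det_submatrix_ne_zero {r : ℕ} (A : Matrix m n ℝ) (f : Fin r → m)
    (g : Fin r → n) (h : (A.submatrix f g).det ≠ 0) : r ≤ A.rank := by
  simpa using card_le_rank_of_det_submatrix_ne_zero A f g h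

theorem exists_linearIndependent_row [Finite m] (A : Matrix m n ℝ) {r : ℕ} (h : r ≤ A.rank) :
    ∃ f : Fin r → m, LinearIndependent ℝ (A.submatrix f id).row := by
  rw [Matrix.rank_eq_finrank_span_row] at h
  obtain ⟨v, hv, -, hli⟩ :=
    Submodule.exists_fun_fin_finrank_span_eq ℝ (Set.range A.row)
  choose f hf using hv
  refine ⟨fun i => f (Fin.castLE h i), ?_⟩
  have := hli.comp (Fin.castLE h) (Fin.castLE_injective h)
  have h1 : (A.submatrix (fun i => f (Fin.castLE h i)) id).row = v ∘ Fin.castLE h :=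
    funext fun i => hf _
  rw [h1]
  exact this

/-- A matrix of rank at least `r` has a nonvanishing `r × r` minor. -/
theorem exists_det_submatrix_ne_zero [Fintype m] (A : Matrix m n ℝ) {r : ℕ} (h : r ≤ A.rank) :
    ∃ (f : Fin r → m) (g : Fin r → n), (A.submatrix f g).det ≠ 0 := by
  obtain ⟨f, hf⟩ := exists_linearIndependent_row A h
  have h1 : r ≤ (A.submatrix f id).transpose.rank := by
    rw [Matrix.rank_transpose, hf.rank_matrix, Fintype.card_fin]
  obtain ⟨g, hg⟩ := exists_linearIndependent_row _ h1
  refine ⟨f, g, ?_⟩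
  have h2 := Matrix.linearIndependent_rows_iff_isUnit.mp hg
  rw [Matrix.isUnit_iff_isUnit_det] at h2
  have h3 := h2.ne_zero
  rw [← Matrix.det_transpose] at h3
  exact h3

/-- The skeleton (CUR) decomposition: a matrix of rank at most `r` is determined by `r` of its rows
and `r` of its columns, if these meet in an invertible matrix. -/
theorem skeleton_decomposition [Fintype m] {r : ℕ} (A : Matrix m n ℝ) (hr : A.rank ≤ r)
    (f : Fin r → m) (g : Fin r → n) (h : IsUnit (A.submatrix f g).det) :
    A = A.submatrix id g * (A.submatrix f g)⁻¹ * A.submatrix f id := by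
  have hli : LinearIndependent ℝ (fun b => A.col (g b)) := by
    have h2 : LinearIndependent ℝ (A.submatrix f g).col := by
      rw [Matrix.linearIndependent_cols_iff_isUnit, Matrix.isUnit_iff_isUnit_det]
      exact h
    exact LinearIndependent.of_comp (LinearMap.funLeft ℝ ℝ f) h2
  have hspan : Submodule.span ℝ (Set.range fun b => A.col (g b)) =
      Submodule.span ℝ (Set.range A.col) := by
    refine Submodule.eq_of_le_of_finrank_le (Submodule.span_mono ?_) ?_
    · rintro _ ⟨b, rfl⟩
      exact ⟨g b, rfl⟩
    · rw [← Matrix.rank_eq_finrank_span_cols, finrank_span_eq_card hli, Fintype.card_fin]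
      exact hr
  have hX : ∀ j, ∃ c : Fin r → ℝ, ∑ b, c b • A.col (g b) = A.col j := fun j => by
    rw [← Submodule.mem_span_range_iff_exists_fun, hspan]
    exact Submodule.subset_span ⟨j, rfl⟩
  choose X hX using hX
  have hA : A = A.submatrix id g * Matrix.of (fun b j => X j b) := by
    ext i j
    rw [Matrix.mul_apply, ← Matrix.col_apply A, ← hX j]
    simp [mul_comm]
  have hf : A.submatrix f id = A.submatrix f g * Matrix.of (fun b j => X j b) := by
    ext i j
    exact congrFun (congrFun hA (f i)) j
  rw [hf, Matrix.mul_assoc, Matrix.nonsing_inv_mul_cancel_left _ _ h]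
  exact hA

/-- Matrices with a nonvanishing `r × r` minor form an open set. -/
theorem isOpen_setOf_le_rank [Fintype m] {X : Type*} [TopologicalSpace X] (A : X → Matrix m n ℝ)
    (hA : Continuous A) (r : ℕ) : IsOpen {x | r ≤ (A x).rank} := by
  have : {x | r ≤ (A x).rank} =
      ⋃ (f : Fin r → m), ⋃ (g : Fin r → n), {x | ((A x).submatrix f g).det ≠ 0} := by
    ext x
    simp only [Set.mem_ofPred_eq, Set.mem_iUnion]
    exact ⟨exists_det_submatrix_ne_zero _, fun ⟨f, g, h⟩ =>
      le_rank_of_det_submatrix_ne_zero _ f g h⟩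
  rw [this]
  refine isOpen_iUnion fun f => isOpen_iUnion fun g => ?_
  exact isOpen_ne_fun (hA.matrix_submatrix f g).matrix_det continuous_const

end Rank

/-- A matrix whose columns on `p` are linearly independent can be changed in the other columns
into an invertible matrix. -/
theorem exists_isUnit_of_linearIndependent {N : ℕ} {ι : Type*} (e : ι → Fin N)
    (he : Function.Injective e) (A : Matrix (Fin N) (Fin N) ℝ)
    (h : LinearIndependent ℝ fun b => A.col (e b)) :
    ∃ g : Matrix (Fin N) (Fin N) ℝ, IsUnit g ∧ ∀ x b, g x (e b) = A x (e b) := by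
  have h0 : LinearIndependent ℝ fun b => (Pi.single (e b) 1 : Fin N → ℝ) := by
    have := (Pi.basisFun ℝ (Fin N)).linearIndependent.comp e he
    convert this using 1
    funext b
    simp
  let φ := (h0.linearCombinationEquiv).symm.trans h.linearCombinationEquiv
  obtain ⟨g, hg⟩ := Submodule.exists_linearEquiv_restrict_eq φ
  refine ⟨LinearMap.toMatrix' g.toLinearMap, ?_, fun x b => ?_⟩
  · refine IsUnit.of_mul_eq_one (LinearMap.toMatrix' g.symm.toLinearMap) ?_
    rw [← LinearMap.toMatrix'_comp]
    simp
  · have h1 : Pi.single (e b) 1 ∈ Submodule.span ℝ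
        (Set.range fun b => (Pi.single (e b) 1 : Fin N → ℝ)) := Submodule.subset_span ⟨b, rfl⟩
    have h2 := hg ⟨_, h1⟩
    have h3 : h0.linearCombinationEquiv.symm ⟨_, h1⟩ = Finsupp.single b 1 := by
      rw [LinearEquiv.symm_apply_eq]
      ext1
      simp
    have h4 : (φ ⟨_, h1⟩ : Fin N → ℝ) = A.col (e b) := by simp [φ, h3]
    rw [h4] at h2
    have h5 := congrFun h2 x
    simp only [Matrix.col_apply] at h5
    rw [LinearMap.toMatrix'_apply, h5]
    simp

/-- A small multiple of the identity makes a matrix invertible. -/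
theorem eventually_isUnit_add_smul_one {N : ℕ} (A : Matrix (Fin N) (Fin N) ℝ) :
    ∀ᶠ t in nhdsWithin (0 : ℝ) {0}ᶜ, IsUnit (A + t • (1 : Matrix (Fin N) (Fin N) ℝ)) := by
  have h : {t : ℝ | Polynomial.IsRoot (-A).charpoly t}.Finite :=
    Polynomial.finite_setOfPred_isRoot (Matrix.charpoly_monic _).ne_zero
  filter_upwards [nhdsNE_le_cofinite 0 h.compl_mem_cofinite] with t ht
  rw [Matrix.isUnit_iff_isUnit_det, isUnit_iff_ne_zero]
  intro h0
  apply ht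
  change Polynomial.eval t (-A).charpoly = 0
  rw [Matrix.eval_charpoly, ← h0]
  congr 1
  ext i j
  simp [Matrix.scalar_apply, Matrix.one_apply, Matrix.diagonal_apply, add_comm]

end

section

variable {d : ℕ}

/-! ### Multi-indices and partial contractions of tensor trains -/

/-- Multi-indices of a tensor of format `n`. -/
abbrev Index (n : Fin d → ℕ) : Type := ∀ i, Fin (n i)

/-- The multi-index that agrees with `k` on the modes in `q` and with `b` elsewhere. -/
def mix {n : Fin d → ℕ} (q : Fin d → Bool) (k b : Index n) : Index n :=
  fun i => if q i then k i else b i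

/-- The modes to the left of the `j`-th bond. -/
def cut (j : Fin (d + 1)) (i : Fin d) : Bool := decide (i.val < j.val)

section mix

variable {n : Fin d → ℕ}

@[simp] theorem mix_self (q : Fin d → Bool) (k : Index n) : mix q k k = k := by
  funext i
  simp [mix]

theorem mix_cut_succ (i : Fin d) (k b : Index n) :
    mix (cut i.succ) k b = Function.update (mix (cut i.castSucc) k b) i (k i) := by
  funext l
  rcases eq_or_ne l i with rfl | hl
  · simp [mix, cut]
  · have : (l : ℕ) ≠ i := fun h => hl (Fin.ext h)
    have h2 : l.val < i.val + 1 ↔ l.val < i.val := by omega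
    simp [mix, cut, hl, h2]

theorem mix_cut_succ_eq_update (i : Fin d) (k b : Index n) :
    mix (cut i.succ) k b = mix (cut i.castSucc) k (Function.update b i (k i)) := by
  rw [mix_cut_succ]
  funext l
  rcases eq_or_ne l i with rfl | hl
  · simp [mix, cut]
  · simp [mix, hl]

@[simp] theorem mix_cut_zero (k b : Index n) : mix (cut 0) k b = b := by
  funext l
  simp [mix, cut]

@[simp] theorem mix_cut_last (k b : Index n) : mix (cut (Fin.last d)) k b = k := by
  funext l
  simp [mix, cut]

theorem update_mix_cut_of_lt (i l : Fin d) (k b : Index n) (x : Fin (n i)) (h : l < i) :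
    Function.update (mix (cut i.castSucc) k b) i x l = k l := by
  have : (l : ℕ) < i := h
  rw [Function.update_of_ne h.ne]
  simp [mix, cut, this]

theorem update_mix_cut_of_gt (i l : Fin d) (k b : Index n) (x : Fin (n i)) (h : i < l) :
    Function.update (mix (cut i.castSucc) k b) i x l = b l := by
  have : ¬ (l : ℕ) < i := fun h' => lt_asymm h h'
  rw [Function.update_of_ne h.ne']
  simp [mix, cut, this]

end mix

/-- A sum of products along paths, in which the sums over the bonds are carried out one after the
other from the left. -/
theorem sum_paths (d : ℕ) (s : Fin (d + 1) → ℕ)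
    (M : ∀ i : Fin d, Matrix (Fin (s i.castSucc)) (Fin (s i.succ)) ℝ)
    (u : ∀ j, Fin (s j) → ℝ)
    (hu : ∀ i β, u (Fin.succ i) β = ∑ α, u i.castSucc α * M i α β) :
    ∑ α : ∀ j, Fin (s j), u 0 (α 0) * ∏ i : Fin d, M i (α i.castSucc) (α i.succ) =
      ∑ β, u (Fin.last d) β := by
  induction d with
  | zero =>
    simp only [Finset.univ_eq_empty, Finset.prod_empty, mul_one]
    let _ : Unique (Fin (0 + 1)) := inferInstanceAs (Unique (Fin 1))
    exact Fintype.sum_equiv (Equiv.piUnique fun j : Fin (0 + 1) => Fin (s j))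
      (fun α => u 0 (α 0)) (fun β => u (Fin.last 0) β) fun α => rfl
  | succ d ih =>
    have h := ih (fun j => s j.succ) (fun i => M i.succ) (fun j => u j.succ)
      (fun i β => hu i.succ β)
    rw [← Fin.succ_last, ← h]
    rw [← (Fin.consEquiv fun j => Fin (s j)).sum_comp, Fintype.sum_prod_type, Finset.sum_comm]
    refine Finset.sum_congr rfl fun α _ => ?_
    have h0 := hu 0 (α 0)
    simp only [Fin.prod_univ_succ, Fin.consEquiv_apply, Fin.cons_zero, Fin.cons_succ,
      Fin.castSucc_zero]
    have h1 := congrArg (· * ∏ i : Fin d, M i.succ (α i.castSucc) (α i.succ)) h0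
    simp only [Finset.sum_mul, mul_assoc] at h1
    exact h1.symm

section cores

variable {n : Fin d → ℕ} {s : Fin (d + 1) → ℕ}
  (F : ∀ i : Fin d, Fin (s i.castSucc) → Fin (n i) → Fin (s i.succ) → ℝ)

/-- The contraction of the cores to the left of the `j`-th bond, with physical indices `k`. -/
noncomputable def leftVec (k : Index n) : ∀ j, Fin (s j) → ℝ :=
  Fin.induction (motive := fun j => Fin (s j) → ℝ) (fun _ => 1)
    fun i u β => ∑ α, u α * F i α (k i) β

/-- The contraction of the cores to the right of the `j`-th bond, with physical indices `k`. -/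
noncomputable def rightVec (k : Index n) : ∀ j, Fin (s j) → ℝ :=
  Fin.reverseInduction (motive := fun j => Fin (s j) → ℝ) (fun _ => 1)
    fun i w α => ∑ β, F i α (k i) β * w β

@[simp] theorem leftVec_zero (k : Index n) : leftVec F k 0 = fun _ => 1 := rfl

theorem leftVec_succ (k : Index n) (i : Fin d) (β : Fin (s i.succ)) :
    leftVec F k i.succ β = ∑ α, leftVec F k i.castSucc α * F i α (k i) β := by
  simp [leftVec]

@[simp] theorem rightVec_last (k : Index n) : rightVec F k (Fin.last d) = fun _ => 1 := by
  simp [rightVec]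

theorem rightVec_castSucc (k : Index n) (i : Fin d) (α : Fin (s i.castSucc)) :
    rightVec F k i.castSucc α = ∑ β, F i α (k i) β * rightVec F k i.succ β := by
  simp [rightVec]

theorem leftVec_congr {k k' : Index n} (j : Fin (d + 1))
    (h : ∀ l : Fin d, l.val < j.val → k l = k' l) : leftVec F k j = leftVec F k' j := by
  induction j using Fin.induction with
  | zero => rfl
  | succ i ih =>
    funext β
    rw [leftVec_succ, leftVec_succ, ih fun l hl => h l (by simp at hl ⊢; omega), h i (by simp)]

theorem rightVec_congr {k k' : Index n} (j : Fin (d + 1))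
    (h : ∀ l : Fin d, j.val ≤ l.val → k l = k' l) : rightVec F k j = rightVec F k' j := by
  induction j using Fin.reverseInduction with
  | last => simp
  | cast i ih =>
    funext β
    rw [rightVec_castSucc, rightVec_castSucc, ih fun l hl => h l (by simp at hl ⊢; omega),
      h i (by simp)]

theorem ofCores_eq_sum_leftVec (k : Index n) :
    ofCores F k = ∑ β, leftVec F k (Fin.last d) β := by
  rw [← sum_paths d s (fun i => Matrix.of fun α β => F i α (k i) β) (leftVec F k)
    (leftVec_succ F k)]
  simp [ofCores]

/-- A tensor train, contracted on both sides of a bond. -/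
theorem ofCores_eq_sum_bond (k : Index n) (j : Fin (d + 1)) :
    ofCores F k = ∑ β, leftVec F k j β * rightVec F k j β := by
  induction j using Fin.reverseInduction with
  | last => simp [ofCores_eq_sum_leftVec]
  | cast i ih =>
    rw [ih]
    simp only [leftVec_succ, rightVec_castSucc, Finset.sum_mul, Finset.mul_sum]
    rw [Finset.sum_comm]
    simp only [mul_assoc]

theorem ofCores_mix_cut (k b : Index n) (j : Fin (d + 1)) :
    ofCores F (mix (cut j) k b) = ∑ β, leftVec F k j β * rightVec F b j β := by
  rw [ofCores_eq_sum_bond F _ j]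
  rw [leftVec_congr F (k' := k), rightVec_congr F (k' := b)]
  · intro l hl
    simp [mix, cut, hl]
  · intro l hl
    simp [mix, cut, hl]

/-- A tensor train, contracted on both sides of a core. -/
theorem ofCores_update_mix_cut (k b : Index n) (i : Fin d)
    (x : Fin (n i)) :
    ofCores F (Function.update (mix (cut i.castSucc) k b) i x) =
      ∑ α, ∑ β, leftVec F k i.castSucc α * F i α x β * rightVec F b i.succ β := by
  rw [ofCores_eq_sum_bond F _ i.castSucc]
  rw [leftVec_congr F (k' := k)]
  · simp only [rightVec_castSucc, Finset.mul_sum, mul_assoc]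
    rw [rightVec_congr F (k' := b)]
    · simp
    · intro l hl
      exact update_mix_cut_of_gt _ _ _ _ _ (Fin.lt_def.mpr (by simp at hl; omega))
  · intro l hl
    exact update_mix_cut_of_lt _ _ _ _ _ (Fin.lt_def.mpr hl)

end cores

end

section

variable {d : ℕ}

/-! ### Matrices acting on tensors -/

section matAct

variable {n : Fin d → ℕ}

/-- The action of tuples of not necessarily invertible matrices on tensors. -/
noncomputable def matAct (g : MatProd n) (T : Tensor n) : Tensor n :=
  fun k => ∑ l : Index n, (∏ i, g i (k i) (l i)) * T l

theorem smul_eq_matAct (g : GLProd n) (T : Tensor n) : g • T = matAct g.val T := rfl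

theorem isUnit_matProd {g : MatProd n} (h : ∀ i, IsUnit (g i)) : IsUnit g :=
  Pi.isUnit_iff.mpr h

theorem isUnit_matProd_apply {g : MatProd n} (h : IsUnit g) (i : Fin d) : IsUnit (g i) :=
  Pi.isUnit_iff.mp h i

theorem flattening_matAct (p : Fin d → Prop) [DecidablePred p] (g : MatProd n) (T : Tensor n) :
    flattening p (matAct g T) =
      (Matrix.of fun b b' : ∀ i : {i // ¬ p i}, Fin (n i) =>
        ∏ i : {i // ¬ p i}, g i (b i) (b' i)) *
        flattening p T *
      (Matrix.of fun a' a : ∀ i : {i // p i}, Fin (n i) =>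
        ∏ i : {i // p i}, g i (a i) (a' i)) := by
  ext b a
  simp only [Matrix.mul_apply, flattening, matAct, Matrix.of_apply, Finset.sum_mul]
  rw [← (Equiv.piEquivPiSubtypeProd p fun i => Fin (n i)).symm.sum_comp, Fintype.sum_prod_type]
  refine Finset.sum_congr rfl fun a' _ => Finset.sum_congr rfl fun b' _ => ?_
  rw [← Fintype.prod_subtype_mul_prod_subtype p]
  have h1 : ∀ i : {i // p i}, g i
      ((Equiv.piEquivPiSubtypeProd p fun i => Fin (n i)).symm (a, b) i)
      ((Equiv.piEquivPiSubtypeProd p fun i => Fin (n i)).symm (a', b') i) = g i (a i) (a' i) :=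
    fun i => by simp [Equiv.piEquivPiSubtypeProd, i.2]
  have h2 : ∀ i : {i // ¬ p i}, g i
      ((Equiv.piEquivPiSubtypeProd p fun i => Fin (n i)).symm (a, b) i)
      ((Equiv.piEquivPiSubtypeProd p fun i => Fin (n i)).symm (a', b') i) = g i (b i) (b' i) :=
    fun i => by simp [Equiv.piEquivPiSubtypeProd, i.2]
  simp only [h1, h2]
  ring

theorem rank_flattening_matAct_le (p : Fin d → Prop) [DecidablePred p] (g : MatProd n)
    (T : Tensor n) : (flattening p (matAct g T)).rank ≤ (flattening p T).rank := by
  rw [flattening_matAct]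
  exact (Matrix.rank_mul_le_left _ _).trans (Matrix.rank_mul_le_right _ _)

theorem rank_flattening_smul (p : Fin d → Prop) [DecidablePred p] (g : GLProd n)
    (T : Tensor n) : (flattening p (g • T)).rank = (flattening p T).rank := by
  refine le_antisymm (rank_flattening_matAct_le p g.val T) ?_
  have := rank_flattening_matAct_le p (g⁻¹).val (g • T)
  rwa [← smul_eq_matAct, inv_smul_smul] at this

/-- The flattening of `T` at a set `q` of modes, as a square matrix indexed by all multi-indices: the
superfluous entries of the row and column indices are ignored. -/
def mixMat (q : Fin d → Bool) (T : Tensor n) : Matrix (Index n) (Index n) ℝ :=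
  Matrix.of fun b k => T (mix q k b)

theorem rank_flattening (p : Fin d → Prop) [DecidablePred p] (T : Tensor n) (k₀ : Index n) :
    (flattening p T).rank = (mixMat (fun i => decide (p i)) T).rank := by
  have h1 : flattening p T = (mixMat (fun i => decide (p i)) T).submatrix
      (fun b i => if h : p i then k₀ i else b ⟨i, h⟩)
      (fun a i => if h : p i then a ⟨i, h⟩ else k₀ i) := by
    ext b a
    simp only [flattening, mixMat, Matrix.of_apply, Matrix.submatrix_apply]
    congr 1
    funext i
    by_cases h : p i <;> simp [mix, h, Equiv.piEquivPiSubtypeProd]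
  have h2 : mixMat (fun i => decide (p i)) T = (flattening p T).submatrix
      (fun b i => b i) (fun k i => k i) := by
    ext b k
    simp only [flattening, mixMat, Matrix.of_apply, Matrix.submatrix_apply]
    congr 1
    funext i
    by_cases h : p i <;> simp [mix, h, Equiv.piEquivPiSubtypeProd]
  apply le_antisymm
  · rw [h1]
    exact Matrix.rank_submatrix_le _ _ _
  · rw [h2]
    exact Matrix.rank_submatrix_le _ _ _

theorem ttRank_eq (T : Tensor n) (k₀ : Index n) (j : Fin (d + 1)) :
    ttRank T j = (mixMat (cut j) T).rank :=
  rank_flattening (fun i : Fin d => i.val < j.val) T k₀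

theorem multilinearRank_eq (T : Tensor n) (k₀ : Index n) (i : Fin d) :
    multilinearRank T i = (mixMat (fun l => decide (l = i)) T).rank := by
  unfold multilinearRank
  convert rank_flattening (fun k : Fin d => k = i) T k₀

end matAct

/-! ### The base tensor -/

section base

variable {n : Fin d → ℕ} {s : Fin (d + 1) → ℕ} (h : ∀ i : Fin d, s i.castSucc * s i.succ ≤ n i)

/-- The index, in the `i`-th mode, of the basis vector labelled by the pair `(a, b)`. -/
def pairIndex (i : Fin d) (a : Fin (s i.castSucc)) (b : Fin (s i.succ)) : Fin (n i) :=
  blockEquiv (h i) (Sum.inl (a, b))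

theorem pairIndex_inj {i : Fin d} {a a' : Fin (s i.castSucc)} {b b' : Fin (s i.succ)} :
    pairIndex h i a b = pairIndex h i a' b' ↔ a = a' ∧ b = b' := by
  simp [pairIndex]

/-- The multi-index visited by a path `α` of bond indices. -/
def pathIndex (α : ∀ j, Fin (s j)) : Index n := fun i => pairIndex h i (α i.castSucc) (α i.succ)

theorem baseTensor_apply (k : Index n) :
    baseTensor h k = ∑ α : ∀ j, Fin (s j), if k = pathIndex h α then 1 else 0 := by
  simp only [baseTensor, ofCores, funext_iff, pathIndex]
  refine Finset.sum_congr rfl fun α _ => ?_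
  simp only [Finset.prod_ite_zero, Finset.mem_univ, true_imp_iff, Finset.prod_const_one, pairIndex]
  congr

/-- The matrices whose columns labelled by pairs are the fibres of the cores `F`, and whose other
columns are those of the identity matrix. -/
def coreMat (F : ∀ i : Fin d, Fin (s i.castSucc) → Fin (n i) → Fin (s i.succ) → ℝ) : MatProd n :=
  fun i => Matrix.of fun x y => Sum.elim (fun ab : Fin (s i.castSucc) × Fin (s i.succ) =>
    F i ab.1 x ab.2) (fun _ => if x = y then 1 else 0) ((blockEquiv (h i)).symm y)

@[simp] theorem coreMat_pairIndex
    (F : ∀ i : Fin d, Fin (s i.castSucc) → Fin (n i) → Fin (s i.succ) → ℝ)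
    (i : Fin d) (x : Fin (n i)) (a : Fin (s i.castSucc)) (b : Fin (s i.succ)) :
    coreMat h F i x (pairIndex h i a b) = F i a x b := by
  simp [coreMat, pairIndex]

theorem coreMat_self (F : ∀ i : Fin d, Fin (s i.castSucc) → Fin (n i) → Fin (s i.succ) → ℝ)
    (hF : ∀ i a x b, F i a x b = if x = pairIndex h i a b then 1 else 0) : coreMat h F = 1 := by
  funext i
  change _ = (1 : Matrix (Fin (n i)) (Fin (n i)) ℝ)
  ext x y
  obtain ⟨z, rfl⟩ := (blockEquiv (h i)).surjective y
  rcases z with ⟨a, b⟩ | z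
  · rw [← pairIndex, coreMat_pairIndex, hF, Matrix.one_apply]
  · simp [coreMat, Matrix.one_apply]

/-- Matrices act on the base tensor by replacing the cores with some of the columns of the
matrices. -/
theorem matAct_baseTensor (g : MatProd n) :
    matAct g (baseTensor h) = ofCores (s := s) fun i a x b => g i x (pairIndex h i a b) := by
  funext k
  simp only [matAct, baseTensor_apply, Finset.mul_sum, ofCores]
  rw [Finset.sum_comm]
  refine Finset.sum_congr rfl fun α _ => ?_
  simp [pathIndex]

theorem matAct_coreMat (F : ∀ i : Fin d, Fin (s i.castSucc) → Fin (n i) → Fin (s i.succ) → ℝ) :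
    matAct (coreMat h F) (baseTensor h) = ofCores F := by
  simp [matAct_baseTensor]

theorem baseTensor_eq_ofCores :
    baseTensor h = ofCores (s := s) fun i a x b => if x = pairIndex h i a b then 1 else 0 := rfl

/-- If a path agrees with `α` to the left of the `j`-th bond, it passes through `α j`. At the leftmost
bond this holds because there is only one bond index. -/
theorem path_eq_of_left (hs0 : s 0 = 1) {α γ : ∀ j, Fin (s j)} (j : Fin (d + 1))
    (hl : ∀ l : Fin d, l.val < j.val → pathIndex h γ l = pathIndex h α l) : γ j = α j := by
  induction j using Fin.cases with
  | zero =>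
    have : Subsingleton (Fin (s 0)) := by rw [hs0]; infer_instance
    exact Subsingleton.elim _ _
  | succ i => exact ((pairIndex_inj h).mp (hl i (by simp))).2

theorem path_eq_of_right (hsd : s (Fin.last d) = 1) {α γ : ∀ j, Fin (s j)} (j : Fin (d + 1))
    (hl : ∀ l : Fin d, j.val ≤ l.val → pathIndex h γ l = pathIndex h α l) : γ j = α j := by
  induction j using Fin.lastCases with
  | last =>
    have : Subsingleton (Fin (s (Fin.last d))) := by rw [hsd]; infer_instance
    exact Subsingleton.elim _ _
  | cast i => exact ((pairIndex_inj h).mp (hl i (by simp))).1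

theorem pathIndex_injective (hs0 : s 0 = 1) :
    Function.Injective (pathIndex h : (∀ j, Fin (s j)) → Index n) := by
  intro α γ hαγ
  funext j
  exact path_eq_of_left h hs0 j fun l _ => congrFun hαγ l

theorem baseTensor_pathIndex (hs0 : s 0 = 1) (α : ∀ j, Fin (s j)) :
    baseTensor h (pathIndex h α) = 1 := by
  rw [baseTensor_apply, Finset.sum_eq_single α]
  · simp
  · intro γ _ hγ
    rw [if_neg]
    exact fun h' => hγ (pathIndex_injective h hs0 h').symm
  · simp

theorem baseTensor_eq_zero {k : Index n} (hk : ∀ α, k ≠ pathIndex h α) : baseTensor h k = 0 := by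
  rw [baseTensor_apply]
  exact Finset.sum_eq_zero fun α _ => if_neg (hk α)

/-- The entries of the base tensor along two paths `α` and `α'` that are interrupted in mode `i`. -/
theorem baseTensor_update_mix (hs0 : s 0 = 1) (hsd : s (Fin.last d) = 1)
    (α α' : ∀ j, Fin (s j)) (i : Fin d) (x : Fin (n i)) :
    baseTensor h (Function.update (mix (cut i.castSucc) (pathIndex h α) (pathIndex h α')) i x) =
      if x = pairIndex h i (α i.castSucc) (α' i.succ) then 1 else 0 := by
  split_ifs with hx
  · rw [← baseTensor_pathIndex h hs0
      (fun j => if j.val ≤ i.val then α j else α' j)]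
    congr 1
    funext l
    rcases lt_trichotomy l i with hl | rfl | hl
    · rw [update_mix_cut_of_lt _ _ _ _ _ hl]
      have : (l : ℕ) < i := hl
      have h1 : (l : ℕ) + 1 ≤ i := hl
      simp [pathIndex, this.le, h1]
    · simp [pathIndex, hx]
    · rw [update_mix_cut_of_gt _ _ _ _ _ hl]
      have : (i : ℕ) < l := hl
      have h1 : ¬ (l : ℕ) ≤ i := by omega
      have h2 : ¬ (l : ℕ) + 1 ≤ i := by omega
      simp [pathIndex, h1, h2]
  · refine baseTensor_eq_zero h fun γ hγ => hx ?_
    have h1 := path_eq_of_left h hs0 (γ := γ) (α := α) i.castSucc fun l hl => by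
      rw [← hγ, update_mix_cut_of_lt _ _ _ _ _ (Fin.lt_def.mpr hl)]
    have h2 := path_eq_of_right h hsd (γ := γ) (α := α') i.succ fun l hl => by
      rw [← hγ, update_mix_cut_of_gt _ _ _ _ _ (Fin.lt_def.mpr (by simp at hl; omega))]
    rw [← h1, ← h2]
    simpa [pathIndex] using congrFun hγ i

theorem baseTensor_mix_cut (hs0 : s 0 = 1) (hsd : s (Fin.last d) = 1)
    (α α' : ∀ j, Fin (s j)) (j : Fin (d + 1)) :
    baseTensor h (mix (cut j) (pathIndex h α) (pathIndex h α')) =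
      if α j = α' j then 1 else 0 := by
  induction j using Fin.cases with
  | zero =>
    have : Subsingleton (Fin (s 0)) := by rw [hs0]; infer_instance
    rw [if_pos (Subsingleton.elim _ _), mix_cut_zero, baseTensor_pathIndex h hs0]
  | succ i =>
    rw [mix_cut_succ, baseTensor_update_mix h hs0 hsd]
    simp [pathIndex, pairIndex_inj]

end base

end

section

variable {d : ℕ} {n : Fin d → ℕ} {s : Fin (d + 1) → ℕ}

/-! ### Reconstruction of a tensor from crosses in its flattenings -/

section cross

/-- The intersection of the rows `c j` and the columns `r j` of the flattening of `T` at the `j`-th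
bond. -/
def crossMat (r c : ∀ j, Fin (s j) → Index n) (T : Tensor n) (j : Fin (d + 1)) :
    Matrix (Fin (s j)) (Fin (s j)) ℝ :=
  (mixMat (cut j) T).submatrix (c j) (r j)

/-- TT cores of `T`, read off from the entries of `T` in crosses. The factor in the leftmost core
normalizes the contraction over the boundary bond, where the cross is a single entry of `T`. -/
noncomputable def crossCores (r c : ∀ j, Fin (s j) → Index n) (T : Tensor n) :
    ∀ i : Fin d, Fin (s i.castSucc) → Fin (n i) → Fin (s i.succ) → ℝ :=
  fun i α x β => (if i.val = 0 then ∑ a, T (c 0 a) else 1) *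
    ∑ γ, (crossMat r c T i.castSucc)⁻¹ γ α *
      T (Function.update (mix (cut i.castSucc) (r i.castSucc γ) (c i.succ β)) i x)

theorem update_mix_cut_castSucc (i : Fin d) (k b : Index n) (x : Fin (n i)) :
    Function.update (mix (cut i.castSucc) k b) i x =
      mix (cut i.castSucc) k (Function.update b i x) := by
  funext l
  rcases eq_or_ne l i with rfl | hl
  · simp [mix, cut]
  · simp [mix, hl]

/-- A tensor whose flattenings have rank at most `s` is a tensor train of bond dimensions `s`, with
cores read off from crosses, provided that the crosses are invertible. -/
theorem ofCores_crossCores (hd : 0 < d) (hs0 : s 0 = 1) (hsd : s (Fin.last d) = 1)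
    (r c : ∀ j, Fin (s j) → Index n) (T : Tensor n)
    (hT : ∀ j, (mixMat (cut j) T).rank ≤ s j) (hN : ∀ j, IsUnit (crossMat r c T j).det) :
    ofCores (crossCores r c T) = T := by
  have : NeZero d := ⟨hd.ne'⟩
  have hsub0 : Subsingleton (Fin (s 0)) := by rw [hs0]; infer_instance
  funext k
  have hsk : ∀ j k b, T (mix (cut j) k b) = ∑ α, T (mix (cut j) k (c j α)) *
      ∑ γ, (crossMat r c T j)⁻¹ γ α * T (mix (cut j) (r j γ) b) := by
    intro j k b
    have h1 := congrFun (congrFun (skeleton_decomposition (mixMat (cut j) T) (hT j) (c j) (r j)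
      (hN j)) b) k
    simp only [Matrix.mul_apply, Matrix.submatrix_apply, mixMat, Matrix.of_apply, id] at h1
    rw [h1]
    refine Finset.sum_congr rfl fun α _ => ?_
    rw [mul_comm]
    congr 1
    exact Finset.sum_congr rfl fun γ _ => mul_comm _ _
  have hpath := sum_paths d s
    (fun i => Matrix.of fun α β => ∑ γ, (crossMat r c T i.castSucc)⁻¹ γ α *
      T (Function.update (mix (cut i.castSucc) (r i.castSucc γ) (c i.succ β)) i (k i)))
    (fun j α => T (mix (cut j) k (c j α))) (fun i β => by
      simp only [Matrix.of_apply, update_mix_cut_castSucc]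
      rw [mix_cut_succ_eq_update, hsk])
  simp only [mix_cut_last, Finset.sum_const, Finset.card_univ, Fintype.card_fin, hsd, one_smul,
    mix_cut_zero, Matrix.of_apply] at hpath
  rw [← hpath]
  simp only [ofCores]
  refine Finset.sum_congr rfl fun α _ => ?_
  simp only [crossCores]
  rw [Finset.prod_mul_distrib]
  congr 1
  rw [Finset.prod_eq_single (0 : Fin d)]
  · simp only [Fin.val_zero, if_true]
    rw [Fintype.sum_eq_single (α 0) fun b hb => absurd (Subsingleton.elim b _) hb]
  · intro i _ hi
    rw [if_neg]
    exact fun h => hi (Fin.ext h)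
  · simp

end cross

/-! ### Ranks of tensor trains -/

theorem rank_mixMat_cut_ofCores_le
    (F : ∀ i : Fin d, Fin (s i.castSucc) → Fin (n i) → Fin (s i.succ) → ℝ) (j : Fin (d + 1)) :
    (mixMat (cut j) (ofCores F)).rank ≤ s j := by
  have h1 : mixMat (cut j) (ofCores F) = (Matrix.of fun b β => rightVec F b j β) *
      (Matrix.of fun β k => leftVec F k j β) := by
    ext b k
    simp [mixMat, ofCores_mix_cut, Matrix.mul_apply, mul_comm]
  rw [h1]
  exact (Matrix.rank_mul_le_right _ _).trans ((Matrix.rank_le_card_height _).trans (by simp))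

theorem mix_single (i : Fin d) (k b : Index n) :
    mix (fun l => decide (l = i)) k b = Function.update b i (k i) := by
  funext l
  rcases eq_or_ne l i with rfl | hl
  · simp [mix]
  · simp [mix, hl]

/-- The flattening of a tensor train in the `i`-th mode factors through the unfolding of the `i`-th
core. -/
theorem mixMat_single_ofCores
    (F : ∀ i : Fin d, Fin (s i.castSucc) → Fin (n i) → Fin (s i.succ) → ℝ) (i : Fin d) :
    mixMat (fun l => decide (l = i)) (ofCores F) =
      (Matrix.of fun (b : Index n) (p : Fin (s i.castSucc) × Fin (s i.succ)) =>
        leftVec F b i.castSucc p.1 * rightVec F b i.succ p.2) *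
      (Matrix.of fun (p : Fin (s i.castSucc) × Fin (s i.succ)) x => F i p.1 x p.2).submatrix id
        fun k : Index n => k i := by
  ext b k
  have h1 := ofCores_update_mix_cut F b b i (k i)
  rw [mix_self] at h1
  simp only [mixMat, mix_single, Matrix.of_apply, h1, Matrix.mul_apply, Matrix.submatrix_apply, id,
    Fintype.sum_prod_type]
  refine Finset.sum_congr rfl fun α _ => Finset.sum_congr rfl fun β _ => ?_
  ring

theorem rank_mixMat_single_ofCores_le
    (F : ∀ i : Fin d, Fin (s i.castSucc) → Fin (n i) → Fin (s i.succ) → ℝ) (i : Fin d) :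
    (mixMat (fun l => decide (l = i)) (ofCores F)).rank ≤
      (Matrix.of fun (p : Fin (s i.castSucc) × Fin (s i.succ)) x => F i p.1 x p.2).rank := by
  rw [mixMat_single_ofCores]
  exact (Matrix.rank_mul_le_right _ _).trans (Matrix.rank_submatrix_le _ _ _)

section

variable (h : ∀ i : Fin d, s i.castSucc * s i.succ ≤ n i) (hs : ∀ j, 1 ≤ s j)

/-- The multi-index visited by the path that passes through `γ` at the `j`-th bond and through `0` at
the other bonds. -/
def crossIndex (j : Fin (d + 1)) (γ : Fin (s j)) : Index n :=
  pathIndex h (Function.update (fun l => ⟨0, hs l⟩) j γ)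

theorem baseTensor_mix_crossIndex (hs0 : s 0 = 1) (hsd : s (Fin.last d) = 1) (j : Fin (d + 1))
    (γ β : Fin (s j)) :
    baseTensor h (mix (cut j) (crossIndex h hs j γ) (crossIndex h hs j β)) =
      if γ = β then 1 else 0 := by
  rw [crossIndex, crossIndex, baseTensor_mix_cut h hs0 hsd]
  simp

theorem baseTensor_update_crossIndex (hs0 : s 0 = 1) (hsd : s (Fin.last d) = 1) (i : Fin d)
    (γ : Fin (s i.castSucc)) (x : Fin (n i)) (β : Fin (s i.succ)) :
    baseTensor h (Function.update (mix (cut i.castSucc) (crossIndex h hs i.castSucc γ)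
      (crossIndex h hs i.succ β)) i x) = if x = pairIndex h i γ β then 1 else 0 := by
  rw [crossIndex, crossIndex, baseTensor_update_mix h hs0 hsd]
  simp

theorem crossMat_baseTensor (hs : ∀ j, 1 ≤ s j) (hs0 : s 0 = 1)
    (hsd : s (Fin.last d) = 1) (j : Fin (d + 1)) :
    crossMat (crossIndex h hs) (crossIndex h hs) (baseTensor h) j = 1 := by
  ext γ β
  simp only [crossMat, mixMat, Matrix.submatrix_apply, Matrix.of_apply,
    baseTensor_mix_crossIndex h hs hs0 hsd, Matrix.one_apply, eq_comm]

theorem rank_mixMat_cut_baseTensor (hs : ∀ j, 1 ≤ s j) (hs0 : s 0 = 1)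
    (hsd : s (Fin.last d) = 1) (j : Fin (d + 1)) :
    (mixMat (cut j) (baseTensor h)).rank = s j := by
  refine le_antisymm (rank_mixMat_cut_ofCores_le _ j) ?_
  refine le_rank_of_det_submatrix_ne_zero _ (crossIndex h hs j) (crossIndex h hs j) ?_
  have h1 := crossMat_baseTensor h hs hs0 hsd j
  rw [crossMat] at h1
  simp [h1]

theorem rank_mixMat_single_baseTensor (hs : ∀ j, 1 ≤ s j) (hs0 : s 0 = 1)
    (hsd : s (Fin.last d) = 1) (i : Fin d) :
    (mixMat (fun l => decide (l = i)) (baseTensor h)).rank = s i.castSucc * s i.succ := by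
  refine le_antisymm ?_ ?_
  · refine (rank_mixMat_single_ofCores_le _ i).trans ?_
    exact (Matrix.rank_le_card_height _).trans (by simp)
  · -- the paths through `a` and `b` at the bonds of the `i`-th core give an identity submatrix
    let f : Fin (s i.castSucc) × Fin (s i.succ) → Index n := fun p =>
      pathIndex h (Function.update (Function.update (fun l => ⟨0, hs l⟩) i.castSucc p.1) i.succ p.2)
    have h1 : (mixMat (fun l => decide (l = i)) (baseTensor h)).submatrix f f = 1 := by
      ext p q
      have hne : i.castSucc ≠ i.succ := (Fin.castSucc_lt_succ).ne
      have h2 := baseTensor_update_mix h hs0 hsd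
        (Function.update (Function.update (fun l => ⟨0, hs l⟩) i.castSucc p.1) i.succ p.2)
        (Function.update (Function.update (fun l => ⟨0, hs l⟩) i.castSucc p.1) i.succ p.2) i
        (f q i)
      rw [mix_self] at h2
      simp only [Matrix.submatrix_apply, mixMat, mix_single, Matrix.of_apply]
      refine h2.trans ?_
      simp [f, pathIndex, pairIndex_inj, hne, Matrix.one_apply, Prod.ext_iff, eq_comm]
    have h3 := card_le_rank_of_det_submatrix_ne_zero _ f f (by rw [h1, Matrix.det_one]; simp)
    simpa using h3

end

/-! ### Tensors of prescribed TT rank -/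

section ttRankSet

variable (h : ∀ i : Fin d, s i.castSucc * s i.succ ≤ n i)

theorem rank_mixMat_boundary {q : Fin d → Bool} {T : Tensor n} (hT : T ≠ 0)
    (hq : (∀ k b : Index n, mix q k b = b) ∨ ∀ k b : Index n, mix q k b = k) :
    (mixMat q T).rank = 1 := by
  obtain ⟨k, hk⟩ := Function.ne_iff.mp hT
  refine le_antisymm ?_ ?_
  · rcases hq with hq | hq
    · have : mixMat q T = Matrix.vecMulVec T 1 := by
        ext b k
        simp [mixMat, hq, Matrix.vecMulVec_apply]
      rw [this]
      exact Matrix.rank_vecMulVec_le _ _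
    · have : mixMat q T = Matrix.vecMulVec 1 T := by
        ext b k
        simp [mixMat, hq, Matrix.vecMulVec_apply]
      rw [this]
      exact Matrix.rank_vecMulVec_le _ _
  · refine le_rank_of_det_submatrix_ne_zero _ (fun _ => k) (fun _ => k) ?_
    simpa [mixMat] using hk

/-- For tensors in `ttRankSet n s`, the boundary values of the TT rank are `s 0 = s d = 1`. -/
theorem mem_ttRankSet_iff (k₀ : Index n) (hd : 2 ≤ d) (hs0 : s 0 = 1) (hsd : s (Fin.last d) = 1)
    (hs : ∀ j, 1 ≤ s j) (T : Tensor n) :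
    T ∈ ttRankSet n s ↔ ∀ j, (mixMat (cut j) T).rank = s j := by
  constructor
  · intro hT
    have hT0 : T ≠ 0 := by
      rintro rfl
      -- as `d ≥ 2`, the bond `1` is not at the boundary, so the rank there is prescribed
      have h1 := hT ⟨1, by omega⟩ (by simp [Fin.ext_iff]) (by simp [Fin.ext_iff]; omega)
      have h2 := hs ⟨1, by omega⟩
      rw [ttRank_eq _ k₀] at h1
      have h3 : mixMat (cut ⟨1, by omega⟩) (0 : Tensor n) = 0 := by
        ext b k
        simp [mixMat]
      rw [h3, Matrix.rank_zero] at h1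
      omega
    intro j
    by_cases h0 : j = 0
    · rw [h0, hs0]
      exact rank_mixMat_boundary hT0 (Or.inl fun k b => by simp)
    by_cases h1 : j = Fin.last d
    · rw [h1, hsd]
      exact rank_mixMat_boundary hT0 (Or.inr fun k b => by simp)
    rw [← ttRank_eq T k₀]
    exact hT j h0 h1
  · intro hT j _ _
    rw [ttRank_eq T k₀]
    exact hT j

theorem mem_ttManifold_iff (k₀ : Index n) (hd : 2 ≤ d) (hs0 : s 0 = 1) (hsd : s (Fin.last d) = 1)
    (hs : ∀ j, 1 ≤ s j) (T : Tensor n) :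
    T ∈ ttManifold n s ↔ (∀ j, (mixMat (cut j) T).rank = s j) ∧
      ∀ i, (mixMat (fun l => decide (l = i)) T).rank = s i.castSucc * s i.succ := by
  simp only [ttManifold, Set.mem_ofPred_eq, mem_ttRankSet_iff k₀ hd hs0 hsd hs,
    multilinearRank_eq T k₀]

/-- TT decomposition: a tensor of TT rank `s` is a tensor train of bond dimensions `s`. -/
theorem exists_ofCores (k₀ : Index n) (hd : 2 ≤ d) (hs0 : s 0 = 1) (hsd : s (Fin.last d) = 1)
    (hs : ∀ j, 1 ≤ s j) {T : Tensor n} (hT : T ∈ ttRankSet n s) :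
    ∃ F : ∀ i : Fin d, Fin (s i.castSucc) → Fin (n i) → Fin (s i.succ) → ℝ, ofCores F = T := by
  rw [mem_ttRankSet_iff k₀ hd hs0 hsd hs] at hT
  choose c r hcr using fun j => exists_det_submatrix_ne_zero (mixMat (cut j) T) (hT j).ge
  exact ⟨crossCores r c T, ofCores_crossCores (by omega) hs0 hsd r c T (fun j => (hT j).le)
    fun j => isUnit_iff_ne_zero.mpr (hcr j)⟩

theorem smul_mem_ttRankSet (g : GLProd n) {T : Tensor n} (hT : T ∈ ttRankSet n s) :
    g • T ∈ ttRankSet n s := by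
  intro j h0 h1
  rw [← hT j h0 h1, ttRank, rank_flattening_smul, ttRank]

theorem smul_mem_ttManifold (g : GLProd n) {T : Tensor n} (hT : T ∈ ttManifold n s) :
    g • T ∈ ttManifold n s := by
  refine ⟨smul_mem_ttRankSet g hT.1, fun i => ?_⟩
  rw [← hT.2 i]
  unfold multilinearRank
  convert rank_flattening_smul (fun k : Fin d => k = i) g T

theorem multilinearRank_le (k₀ : Index n) (hd : 2 ≤ d) (hs0 : s 0 = 1)
    (hsd : s (Fin.last d) = 1) (hs : ∀ j, 1 ≤ s j) {T : Tensor n} (hT : T ∈ ttRankSet n s)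
    (i : Fin d) : multilinearRank T i ≤ s i.castSucc * s i.succ := by
  obtain ⟨F, rfl⟩ := exists_ofCores k₀ hd hs0 hsd hs hT
  rw [multilinearRank_eq _ k₀]
  exact (rank_mixMat_single_ofCores_le F i).trans ((Matrix.rank_le_card_height _).trans (by simp))

/-- If the multilinear rank is maximal, then the unfoldings of the cores have full column rank, so
they are the leading columns of invertible matrices. -/
theorem ttManifold_eq_orbit (hd : 2 ≤ d) (hs0 : s 0 = 1) (hsd : s (Fin.last d) = 1)
    (hs : ∀ j, 1 ≤ s j) :
    ttManifold n s = MulAction.orbit (GLProd n) (baseTensor h) := by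
  have k₀ : Index n := pathIndex h fun l => ⟨0, hs l⟩
  apply Set.Subset.antisymm
  · intro T hT
    obtain ⟨F, rfl⟩ := exists_ofCores k₀ hd hs0 hsd hs hT.1
    have hT2 := ((mem_ttManifold_iff k₀ hd hs0 hsd hs _).mp hT).2
    have hg : ∀ i, ∃ g : Matrix (Fin (n i)) (Fin (n i)) ℝ, IsUnit g ∧
        ∀ x (p : Fin (s i.castSucc) × Fin (s i.succ)),
          g x (pairIndex h i p.1 p.2) = F i p.1 x p.2 := by
      intro i
      have h1 := rank_mixMat_single_ofCores_le F i
      rw [hT2, Matrix.rank_eq_finrank_span_row] at h1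
      have h2 : LinearIndependent ℝ (Matrix.of fun (p : Fin (s i.castSucc) × Fin (s i.succ)) x =>
          F i p.1 x p.2).row := by
        rw [linearIndependent_iff_card_le_finrank_span]
        simpa [Set.finrank] using h1
      obtain ⟨g, hg, hgF⟩ := exists_isUnit_of_linearIndependent
        (fun p : Fin (s i.castSucc) × Fin (s i.succ) => pairIndex h i p.1 p.2)
        (fun p q hpq => Prod.ext_iff.mpr ((pairIndex_inj h).mp hpq)) (coreMat h F i) (by
          convert h2 using 1
          funext p x
          simp)
      exact ⟨g, hg, fun x p => by simp [hgF]⟩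
    choose g hg hgF using hg
    refine ⟨(isUnit_matProd (g := g) hg).unit, ?_⟩
    refine (matAct_baseTensor h (show MatProd n from g)).trans ?_
    congr 1
    funext i a x b
    exact hgF i x (a, b)
  · rintro _ ⟨g, rfl⟩
    refine smul_mem_ttManifold g ((mem_ttManifold_iff k₀ hd hs0 hsd hs _).mpr ⟨?_, ?_⟩)
    · exact rank_mixMat_cut_baseTensor h hs hs0 hsd
    · exact rank_mixMat_single_baseTensor h hs hs0 hsd

theorem continuous_mixMat (q : Fin d → Bool) :
    Continuous (mixMat q : Tensor n → Matrix (Index n) (Index n) ℝ) :=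
  continuous_matrix fun _ _ => continuous_apply _

theorem isOpen_ttManifold (k₀ : Index n) (hd : 2 ≤ d) (hs0 : s 0 = 1)
    (hsd : s (Fin.last d) = 1) (hs : ∀ j, 1 ≤ s j) :
    IsOpen {T : ttRankSet n s | (T : Tensor n) ∈ ttManifold n s} := by
  have : {T : ttRankSet n s | (T : Tensor n) ∈ ttManifold n s} = ⋂ i : Fin d, {T : ttRankSet n s |
      s i.castSucc * s i.succ ≤ (mixMat (fun l => decide (l = i)) (T : Tensor n)).rank} := by
    ext T
    simp only [ttManifold, Set.mem_iInter, Set.mem_ofPred_eq, T.2, true_and]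
    refine forall_congr' fun i => ?_
    rw [← multilinearRank_eq _ k₀]
    exact ⟨fun h => h.ge, fun h => le_antisymm (multilinearRank_le k₀ hd hs0 hsd hs T.2 i) h⟩
  rw [this]
  exact isOpen_iInter_of_finite fun i =>
    isOpen_setOf_le_rank _ ((continuous_mixMat _).comp continuous_subtype_val) _

/-- Tensor trains with arbitrary cores are limits of points in the orbit of the base tensor, as
invertible matrices are dense. -/
theorem dense_ttManifold (h : ∀ i : Fin d, s i.castSucc * s i.succ ≤ n i) (hd : 2 ≤ d)
    (hs0 : s 0 = 1) (hsd : s (Fin.last d) = 1) (hs : ∀ j, 1 ≤ s j) :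
    Dense {T : ttRankSet n s | (T : Tensor n) ∈ ttManifold n s} := by
  have k₀ : Index n := pathIndex h fun l => ⟨0, hs l⟩
  rw [Subtype.dense_iff]
  intro T hT
  obtain ⟨F, rfl⟩ := exists_ofCores k₀ hd hs0 hsd hs hT
  let g : ℝ → MatProd n := fun t i => coreMat h F i + t • (1 : Matrix (Fin (n i)) (Fin (n i)) ℝ)
  have hcont : Continuous fun t => matAct (g t) (baseTensor h) := by
    refine continuous_pi fun k => ?_
    simp only [matAct, g, Matrix.add_apply, Matrix.smul_apply, smul_eq_mul]
    fun_prop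
  have h0 : matAct (g 0) (baseTensor h) = ofCores F := by
    rw [← matAct_coreMat h]
    congr 1
    funext i
    simp [g]
  have hlim := (hcont.tendsto 0).mono_left (nhdsWithin_le_nhds (s := {0}ᶜ))
  rw [h0] at hlim
  refine mem_closure_of_tendsto hlim ?_
  have hu : ∀ᶠ t in nhdsWithin (0 : ℝ) {0}ᶜ, ∀ i, IsUnit (g t i) :=
    Filter.eventually_all.mpr fun i => eventually_isUnit_add_smul_one _
  filter_upwards [hu] with t ht
  have h1 : matAct (g t) (baseTensor h) ∈ ttManifold n s := by
    rw [ttManifold_eq_orbit h hd hs0 hsd hs]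
    exact ⟨(isUnit_matProd ht).unit, rfl⟩
  exact ⟨⟨_, h1.1⟩, h1, rfl⟩

/-- A set defined by prescribing finitely many ranks of flattenings, which are bounded by the
prescribed values on a larger set `S`, is Zariski open in the closure of `S`: the bounds hold on the
closure, and the remaining condition is that some product of minors does not vanish. -/
theorem isZariskiOpenInClosure_of_rank {C : Type} [Fintype C] (q : C → Fin d → Bool) (r : C → ℕ)
    {S U : Set (Tensor n)} (hS : ∀ T ∈ S, ∀ c, (mixMat (q c) T).rank ≤ r c) (hUS : U ⊆ S)
    (hU : ∀ T, T ∈ U ↔ ∀ c, (mixMat (q c) T).rank = r c) : IsZariskiOpenInClosure S U := by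
  let minor : ∀ (c : C) (m : ℕ), (Fin m → Index n) → (Fin m → Index n) →
      MvPolynomial (Index n) ℝ := fun c m f g =>
    (Matrix.of fun a b => MvPolynomial.X (mix (q c) (g b) (f a))).det
  have hminor : ∀ c m f g (T : Tensor n), MvPolynomial.aeval T (minor c m f g) =
      ((mixMat (q c) T).submatrix f g).det := by
    intro c m f g T
    simp only [minor]
    rw [AlgHom.map_det]
    congr 1
    ext a b
    simp [mixMat]
  let P : Set (MvPolynomial (Index n) ℝ) := Set.range
    fun fg : (∀ c, Fin (r c) → Index n) × (∀ c, Fin (r c) → Index n) =>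
      ∏ c, minor c (r c) (fg.1 c) (fg.2 c)
  refine ⟨Ideal.span P, ?_⟩
  ext T
  rw [MvPolynomial.zeroLocus_span]
  simp only [Set.mem_sdiff, P, Set.forall_mem_range, Set.mem_ofPred_eq, map_prod, hminor, hU]
  constructor
  · intro hT
    refine ⟨MvPolynomial.zeroLocus_vanishingIdeal_le S (hUS ((hU T).mpr hT)), fun h0 => ?_⟩
    choose f g hfg using fun c => exists_det_submatrix_ne_zero (mixMat (q c) T) (hT c).ge
    exact Finset.prod_ne_zero_iff.mpr (fun c _ => hfg c) (h0 (f, g))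
  · rintro ⟨hcl, hne⟩ c
    apply le_antisymm
    · by_contra! hlt
      obtain ⟨f, g, hfg⟩ := exists_det_submatrix_ne_zero (mixMat (q c) T)
        (Nat.succ_le_of_lt hlt)
      refine hfg ?_
      rw [← hminor]
      refine hcl _ ?_
      rw [MvPolynomial.mem_vanishingIdeal_iff]
      intro T' hT'
      rw [hminor]
      by_contra h0
      have := le_rank_of_det_submatrix_ne_zero _ f g h0
      have := hS T' hT' c
      omega
    · push Not at hne
      obtain ⟨fg, hfg⟩ := hne
      exact le_rank_of_det_submatrix_ne_zero _ _ _
        (Finset.prod_ne_zero_iff.mp hfg c (Finset.mem_univ c))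

theorem isZariskiOpenInClosure_ttManifold (k₀ : Index n) (hd : 2 ≤ d) (hs0 : s 0 = 1)
    (hsd : s (Fin.last d) = 1) (hs : ∀ j, 1 ≤ s j) :
    IsZariskiOpenInClosure (ttRankSet n s) (ttManifold n s) := by
  refine isZariskiOpenInClosure_of_rank (C := Fin (d + 1) ⊕ Fin d)
    (Sum.elim cut fun i l => decide (l = i)) (Sum.elim s fun i => s i.castSucc * s i.succ)
    ?_ (fun T hT => hT.1) ?_
  · rintro T hT (j | i)
    · exact ((mem_ttRankSet_iff k₀ hd hs0 hsd hs T).mp hT j).le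
    · exact (multilinearRank_eq T k₀ i).symm.trans_le (multilinearRank_le k₀ hd hs0 hsd hs hT i)
  · intro T
    rw [mem_ttManifold_iff k₀ hd hs0 hsd hs, Sum.forall]
    rfl

end ttRankSet

end

section

variable {d : ℕ} {n : Fin d → ℕ} {s : Fin (d + 1) → ℕ}

/-! ### The stabilizer of the base tensor -/

section stabilizer

variable (h : ∀ i : Fin d, s i.castSucc * s i.succ ≤ n i)

/-- The slice of the `i`-th core of the base tensor with physical index `x`. -/
def pairMat (i : Fin d) (x : Fin (n i)) : Matrix (Fin (s i.castSucc)) (Fin (s i.succ)) ℝ :=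
  Matrix.of fun a b => if x = pairIndex h i a b then 1 else 0

theorem mul_pairMat_mul_pairIndex (i : Fin d) (γ : Fin (s i.castSucc)) (δ : Fin (s i.succ))
    (P : Matrix (Fin (s i.castSucc)) (Fin (s i.castSucc)) ℝ)
    (Q : Matrix (Fin (s i.succ)) (Fin (s i.succ)) ℝ) (a : Fin (s i.castSucc))
    (b : Fin (s i.succ)) :
    (P * pairMat h i (pairIndex h i γ δ) * Q) a b = P a γ * Q δ b := by
  have h1 : pairMat h i (pairIndex h i γ δ) = Matrix.single γ δ 1 := by
    ext a b
    simp [pairMat, pairIndex_inj, Matrix.single_apply]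
  rw [h1, Matrix.mul_apply, Finset.sum_eq_single δ]
  · simp
  · intro c _ hc
    rw [Matrix.mul_single_apply_of_ne _ _ _ _ _ hc, zero_mul]
  · simp

theorem pairMat_inr (i : Fin d) (z : Fin (n i - s i.castSucc * s i.succ)) :
    pairMat h i (blockEquiv (h i) (Sum.inr z)) = 0 := by
  ext a b
  simp [pairMat, pairIndex]

/-- The gauge freedom of TT cores. -/
theorem ofCores_gauge (F E : ∀ i : Fin d, Fin (s i.castSucc) → Fin (n i) → Fin (s i.succ) → ℝ)
    (A : ∀ j, GL (Fin (s j)) ℝ) (h0 : A 0 = 1) (h1 : A (Fin.last d) = 1)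
    (hF : ∀ i x, (Matrix.of fun a b => F i a x b) =
      ((A i.castSucc)⁻¹).val * (Matrix.of fun a b => E i a x b) * (A i.succ).val) :
    ofCores F = ofCores E := by
  funext k
  have hvec : ∀ j, leftVec F k j = Matrix.vecMul (leftVec E k j) (A j).val := by
    intro j
    induction j using Fin.induction with
    | zero => simp [h0]
    | succ i ih =>
      have e1 : leftVec F k i.succ =
          Matrix.vecMul (leftVec F k i.castSucc) (Matrix.of fun a b => F i a (k i) b) := by
        funext β
        rw [leftVec_succ]
        rfl
      have e2 : leftVec E k i.succ =
          Matrix.vecMul (leftVec E k i.castSucc) (Matrix.of fun a b => E i a (k i) b) := by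
        funext β
        rw [leftVec_succ]
        rfl
      rw [e1, ih, hF, e2]
      simp only [Matrix.vecMul_vecMul, ← Matrix.mul_assoc, Units.mul_inv, Matrix.one_mul]
  rw [ofCores_eq_sum_leftVec, ofCores_eq_sum_leftVec, hvec, h1]
  simp

theorem smul_baseTensor_of_isStabilizerForm (g : GLProd n) (hg : IsStabilizerForm h g.val) :
    g • baseTensor h = baseTensor h := by
  obtain ⟨A, B, M, h0, h1, hg⟩ := hg
  rw [smul_eq_matAct, matAct_baseTensor, baseTensor_eq_ofCores]
  refine ofCores_gauge _ _ A h0 h1 fun i x => ?_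
  change _ = _ * pairMat h i x * _
  ext a b
  rw [Matrix.of_apply, hg]
  obtain ⟨z, rfl⟩ := (blockEquiv (h i)).surjective x
  rcases z with ⟨γ, δ⟩ | z
  · have := mul_pairMat_mul_pairIndex h i γ δ ((A i.castSucc)⁻¹).val (A i.succ).val a b
    rw [pairIndex] at this
    rw [this]
    simp [pairIndex]
  · rw [pairMat_inr]
    simp [pairIndex]

/-- The matrices `A j` of an element of the stabilizer are the contractions of its cores to the left
of the bonds, evaluated on the crosses of the base tensor; the contractions to the right of the bonds
provide their inverses. -/
theorem isStabilizerForm_of_smul_baseTensor (hs : ∀ j, 1 ≤ s j) (hs0 : s 0 = 1)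
    (hsd : s (Fin.last d) = 1) (g : GLProd n) (hg : g • baseTensor h = baseTensor h) :
    IsStabilizerForm h g.val := by
  rw [smul_eq_matAct, matAct_baseTensor] at hg
  set F : ∀ i : Fin d, Fin (s i.castSucc) → Fin (n i) → Fin (s i.succ) → ℝ :=
    fun i a x b => g.val i x (pairIndex h i a b) with hF
  let A : ∀ j, Matrix (Fin (s j)) (Fin (s j)) ℝ := fun j =>
    Matrix.of fun γ β => leftVec F (crossIndex h hs j γ) j β
  let B : ∀ j, Matrix (Fin (s j)) (Fin (s j)) ℝ := fun j =>
    Matrix.of fun β γ => rightVec F (crossIndex h hs j γ) j β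
  have hAB : ∀ j, A j * B j = 1 := by
    intro j
    ext γ β
    rw [Matrix.one_apply, ← baseTensor_mix_crossIndex h hs hs0 hsd, ← hg, ofCores_mix_cut]
    rfl
  have hBA : ∀ j, B j * A j = 1 := fun j => mul_eq_one_comm.mp (hAB j)
  have hcore : ∀ i x, (Matrix.of fun a b => F i a x b) =
      B i.castSucc * pairMat h i x * A i.succ := by
    intro i x
    have h1 : A i.castSucc * (Matrix.of fun a b => F i a x b) * B i.succ = pairMat h i x := by
      ext γ β
      rw [pairMat, Matrix.of_apply, ← baseTensor_update_crossIndex h hs hs0 hsd, ← hg,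
        ofCores_update_mix_cut, Finset.sum_comm]
      simp only [Matrix.mul_apply, Finset.sum_mul]
      rfl
    rw [← h1]
    simp only [Matrix.mul_assoc, hBA, Matrix.mul_one]
    rw [← Matrix.mul_assoc, hBA, Matrix.one_mul]
  have hblock : ∀ i, ∃ (D : GL (Fin (n i - s i.castSucc * s i.succ)) ℝ)
      (M : Matrix (Fin (s i.castSucc) × Fin (s i.succ)) (Fin (n i - s i.castSucc * s i.succ)) ℝ),
      g.val i = Matrix.reindex (blockEquiv (h i)) (blockEquiv (h i))
        (Matrix.fromBlocks ((B i.castSucc).transpose ⊗ₖ A i.succ) M 0 D.val) := by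
    intro i
    let G := Matrix.reindex (blockEquiv (h i)).symm (blockEquiv (h i)).symm (g.val i)
    have h11 : G.toBlocks₁₁ = (B i.castSucc).transpose ⊗ₖ A i.succ := by
      ext ⟨γ, δ⟩ ⟨a, b⟩
      have h1 := congrFun (congrFun (hcore i (pairIndex h i γ δ)) a) b
      rw [mul_pairMat_mul_pairIndex] at h1
      exact h1
    have h21 : G.toBlocks₂₁ = 0 := by
      ext z ⟨a, b⟩
      have h1 := congrFun (congrFun (hcore i (blockEquiv (h i) (Sum.inr z))) a) b
      rw [pairMat_inr, Matrix.mul_zero, Matrix.zero_mul] at h1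
      exact h1
    have hG : G = Matrix.fromBlocks ((B i.castSucc).transpose ⊗ₖ A i.succ) G.toBlocks₁₂ 0
        G.toBlocks₂₂ := by
      rw [← h11, ← h21, Matrix.fromBlocks_toBlocks]
    have hu : IsUnit G := by
      have h2 := isUnit_matProd_apply g.isUnit i
      rw [Matrix.isUnit_iff_isUnit_det] at h2 ⊢
      rwa [Matrix.det_reindex_self]
    rw [hG, Matrix.isUnit_fromBlocks_zero₂₁] at hu
    refine ⟨hu.2.unit, G.toBlocks₁₂, ?_⟩
    rw [IsUnit.unit_spec, ← hG]
    simp [G]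
  choose D M hDM using hblock
  refine ⟨fun j => ⟨A j, B j, hAB j, hBA j⟩, D, M, ?_, ?_, hDM⟩
  · have : Subsingleton (Fin (s 0)) := by rw [hs0]; infer_instance
    refine Units.ext ?_
    ext γ β
    rw [Subsingleton.elim γ β]
    simp [A]
  · have : Subsingleton (Fin (s (Fin.last d))) := by rw [hsd]; infer_instance
    refine Units.ext ?_
    ext γ β
    have h1 := baseTensor_mix_crossIndex h hs hs0 hsd (Fin.last d) γ γ
    rw [mix_self, ← hg, ofCores_eq_sum_leftVec, if_pos rfl,
      Fintype.sum_eq_single γ fun b hb => absurd (Subsingleton.elim b _) hb] at h1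
    rw [Subsingleton.elim β γ]
    simpa [A] using h1

theorem mem_stabilizer_iff_isStabilizerForm (hs : ∀ j, 1 ≤ s j) (hs0 : s 0 = 1)
    (hsd : s (Fin.last d) = 1) (g : GLProd n) :
    g ∈ MulAction.stabilizer (GLProd n) (baseTensor h) ↔ IsStabilizerForm h g.val :=
  ⟨fun hg => isStabilizerForm_of_smul_baseTensor h hs hs0 hsd g hg,
    smul_baseTensor_of_isStabilizerForm h g⟩

end stabilizer

end

section

/-! ### A smooth local section of the orbit map -/

section smooth

variable {E : Type*} [NormedAddCommGroup E] [NormedSpace ℝ E] {x : E} {N : Type*} [Fintype N]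
  [DecidableEq N]

theorem contDiffAt_det {A : E → Matrix N N ℝ} (hA : ∀ i j, ContDiffAt ℝ ∞ (fun y => A y i j) x) :
    ContDiffAt ℝ ∞ (fun y => (A y).det) x := by
  simp only [Matrix.det_apply']
  refine ContDiffAt.sum fun σ _ => contDiffAt_const.mul (contDiffAt_prod fun i _ => hA _ _)

theorem contDiffAt_inv_apply {A : E → Matrix N N ℝ}
    (hA : ∀ i j, ContDiffAt ℝ ∞ (fun y => A y i j) x) (hx : IsUnit (A x).det) (i j : N) :
    ContDiffAt ℝ ∞ (fun y => (A y)⁻¹ i j) x := by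
  simp only [Matrix.inv_def, Matrix.smul_apply, Ring.inverse_eq_inv', Matrix.adjugate_apply,
    smul_eq_mul]
  refine ((contDiffAt_det hA).inv hx.ne_zero).mul (contDiffAt_det fun a b => ?_)
  simp only [Matrix.updateRow_apply]
  split_ifs
  · exact contDiffAt_const
  · exact hA a b

end smooth

variable {d : ℕ} {n : Fin d → ℕ} {s : Fin (d + 1) → ℕ}

/-- `MatProd n` as a space of families of entries. -/
def matProdEntries (n : Fin d → ℕ) :
    MatProd n ≃ₗ[ℝ] (∀ i, Fin (n i) → Fin (n i) → ℝ) where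
  toFun g := g
  invFun g := g
  map_add' _ _ := rfl
  map_smul' _ _ := rfl
  left_inv _ := rfl
  right_inv _ := rfl

instance (n : Fin d → ℕ) : FiniteDimensional ℝ (MatProd n) :=
  (matProdEntries n).symm.finiteDimensional

theorem contDiffAt_matProd {E : Type*} [NormedAddCommGroup E] [NormedSpace ℝ E] {x : E}
    {g : E → MatProd n} (hg : ∀ i a b, ContDiffAt ℝ ∞ (fun y => g y i a b) x) :
    ContDiffAt ℝ ∞ g x := by
  have h1 : ContDiffAt ℝ ∞ (fun y => matProdEntries n (g y)) x := by
    simp only [contDiffAt_pi]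
    exact hg
  exact (matProdEntries n).symm.toContinuousLinearEquiv.contDiff.contDiffAt.comp x h1

theorem contDiff_matProd_apply (i : Fin d) (a b : Fin (n i)) :
    ContDiff ℝ ∞ fun g : MatProd n => g i a b := by
  have h1 : ContDiff ℝ ∞ (matProdEntries n) :=
    (matProdEntries n).toContinuousLinearEquiv.contDiff
  simp only [contDiff_pi] at h1
  exact h1 i a b

theorem contDiff_matAct : ContDiff ℝ ∞ fun p : MatProd n × Tensor n => matAct p.1 p.2 := by
  rw [contDiff_pi]
  intro k
  refine ContDiff.sum fun l _ => ContDiff.mul (contDiff_prod fun i _ => ?_) ?_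
  · exact (contDiff_matProd_apply i _ _).comp contDiff_fst
  · exact (contDiff_apply ℝ ℝ l).comp contDiff_snd

section

variable (h : ∀ i : Fin d, s i.castSucc * s i.succ ≤ n i) (hs : ∀ j, 1 ≤ s j)

/-- A rational map that sends a tensor `T` of the orbit near the base tensor to a tuple of matrices
that moves the base tensor to `T`. -/
noncomputable def sectionMat (T : Tensor n) : MatProd n :=
  coreMat h (crossCores (crossIndex h hs) (crossIndex h hs) T)

theorem sectionMat_baseTensor (hs0 : s 0 = 1) (hsd : s (Fin.last d) = 1) :
    sectionMat h hs (baseTensor h) = 1 := by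
  refine coreMat_self h _ fun i a x b => ?_
  have h0 : ∑ a, baseTensor h (crossIndex h hs 0 a) = 1 := by
    have h1 : ∀ a, baseTensor h (crossIndex h hs 0 a) = 1 := fun a => by
      have := baseTensor_mix_crossIndex h hs hs0 hsd 0 a a
      rwa [mix_self, if_pos rfl] at this
    simp [h1, hs0]
  simp only [crossCores, h0, ite_self, one_mul, crossMat_baseTensor h hs hs0 hsd, inv_one,
    baseTensor_update_crossIndex h hs hs0 hsd]
  rw [Finset.sum_eq_single a]
  · simp
  · intro γ _ hγ
    rw [Matrix.one_apply_ne hγ, zero_mul]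
  · simp

theorem contDiffAt_sectionMat {T : Tensor n}
    (hT : ∀ j, IsUnit (crossMat (crossIndex h hs) (crossIndex h hs) T j).det) :
    ContDiffAt ℝ ∞ (sectionMat h hs) T := by
  have happ : ∀ k : Index n, ContDiffAt ℝ ∞ (fun T' : Tensor n => T' k) T :=
    fun k => (contDiff_apply ℝ ℝ k).contDiffAt
  refine contDiffAt_matProd fun i x y => ?_
  obtain ⟨z, rfl⟩ := (blockEquiv (h i)).surjective y
  rcases z with ⟨a, b⟩ | z
  · simp only [sectionMat, coreMat, Matrix.of_apply, Equiv.symm_apply_apply, Sum.elim_inl,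
      crossCores]
    refine ContDiffAt.mul ?_ (ContDiffAt.sum fun γ _ => ContDiffAt.mul ?_ (happ _))
    · split_ifs
      · exact ContDiffAt.sum fun _ _ => happ _
      · exact contDiffAt_const
    · exact contDiffAt_inv_apply (fun _ _ => happ _) (hT _) _ _
  · simp only [sectionMat, coreMat, Matrix.of_apply, Equiv.symm_apply_apply, Sum.elim_inr]
    exact contDiffAt_const

/-- Near the base tensor, the orbit map has a smooth section that is defined on an open set of
tensors and takes the value `1` at the base tensor. -/
theorem exists_smooth_section (hs : ∀ j, 1 ≤ s j) (hd : 2 ≤ d) (hs0 : s 0 = 1)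
    (hsd : s (Fin.last d) = 1) :
    ∃ (V : Set (Tensor n)) (σ : Tensor n → GLProd n), IsOpen V ∧ baseTensor h ∈ V ∧
      ContDiffOn ℝ ∞ (fun T => (σ T).val) V ∧ σ (baseTensor h) = 1 ∧
      ∀ T ∈ V, T ∈ MulAction.orbit (GLProd n) (baseTensor h) → σ T • baseTensor h = T := by
  classical
  have k₀ : Index n := pathIndex h fun l => ⟨0, hs l⟩
  let V₁ : Set (Tensor n) :=
    {T | ∀ j, IsUnit (crossMat (crossIndex h hs) (crossIndex h hs) T j).det}
  have hV₁ : IsOpen V₁ := by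
    have : V₁ = ⋂ j, {T : Tensor n |
        (crossMat (crossIndex h hs) (crossIndex h hs) T j).det ≠ 0} := by
      ext T
      simp [V₁, isUnit_iff_ne_zero]
    rw [this]
    exact isOpen_iInter_of_finite fun j => isOpen_ne_fun
      ((continuous_mixMat _).matrix_submatrix _ _).matrix_det continuous_const
  have hc : ContDiffOn ℝ ∞ (sectionMat h hs) V₁ := fun T hT =>
    (contDiffAt_sectionMat h hs hT).contDiffWithinAt
  -- the value where `sectionMat` is not invertible is immaterial
  let σ : Tensor n → GLProd n := fun T =>
    if hT : IsUnit (sectionMat h hs T) then hT.unit else 1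
  have hval : ∀ T ∈ V₁ ∩ sectionMat h hs ⁻¹' {g | IsUnit g}, (σ T).val = sectionMat h hs T := by
    intro T hT
    have hT2 : IsUnit (sectionMat h hs T) := hT.2
    simp [σ, hT2]
  refine ⟨V₁ ∩ sectionMat h hs ⁻¹' {g | IsUnit g}, σ,
    hc.continuousOn.isOpen_inter_preimage hV₁ Units.isOpen, ⟨?_, ?_⟩, ?_, ?_, ?_⟩
  · intro j
    rw [crossMat_baseTensor h hs hs0 hsd]
    simp
  · change IsUnit (sectionMat h hs (baseTensor h))
    rw [sectionMat_baseTensor h hs hs0 hsd]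
    exact isUnit_one
  · exact (hc.mono Set.inter_subset_left).congr hval
  · ext1
    have h1 : IsUnit (sectionMat h hs (baseTensor h)) := by
      rw [sectionMat_baseTensor h hs hs0 hsd]
      exact isUnit_one
    simp only [σ, h1, dif_pos]
    exact sectionMat_baseTensor h hs hs0 hsd
  · intro T hT hTo
    rw [smul_eq_matAct, hval T hT, sectionMat, matAct_coreMat]
    rw [← ttManifold_eq_orbit h hd hs0 hsd hs] at hTo
    exact ofCores_crossCores (by omega) hs0 hsd _ _ T
      (fun j => ((mem_ttRankSet_iff k₀ hd hs0 hsd hs T).mp hTo.1 j).le) hT.1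

end

end

section

/-! ### Smooth structures on embedded spaces -/

section charts

variable {E : Type*} [NormedAddCommGroup E] [NormedSpace ℝ E]
  {F : Type*} [NormedAddCommGroup F] [NormedSpace ℝ F]
  {X : Type*} [TopologicalSpace X]

/-- A chart of a space `X` that is mapped to a vector space `E` by `ι` is compatible with `ι` if its
inverse is smooth as a map to `E`, and the chart is the restriction of a linear map on `E`. -/
def IsCompatibleChart (ι : X → E) (e : OpenPartialHomeomorph X F) : Prop :=
  ContDiffOn ℝ ∞ (ι ∘ e.symm) e.target ∧ ∃ r : E →L[ℝ] F, ∀ y ∈ e.source, e y = r (ι y)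

/-- The charted space structure given by a chart around each point. -/
@[reducible] def chartedSpaceOfCharts (e : X → OpenPartialHomeomorph X F)
    (he : ∀ x, x ∈ (e x).source) : ChartedSpace F X where
  atlas := Set.range e
  chartAt := e
  mem_chart_source := he
  chart_mem_atlas := Set.mem_range_self

theorem isManifold_of_isCompatibleChart [ChartedSpace F X] {ι : X → E}
    (h : ∀ e ∈ atlas F X, IsCompatibleChart ι e) : IsManifold 𝓘(ℝ, F) ∞ X := by
  refine isManifold_of_contDiffOn _ _ _ fun e e' he he' => ?_
  obtain ⟨r, hr⟩ := (h e' he').2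
  have h1 := r.contDiff.comp_contDiffOn (h e he).1
  simp only [modelWithCornersSelf_coe, modelWithCornersSelf_coe_symm, Set.range_id, Set.inter_univ,
    Function.id_comp, Function.comp_id, Set.preimage_id]
  refine (h1.mono fun y hy => hy.1).congr fun y hy => ?_
  exact hr _ hy.2

theorem contMDiff_of_isCompatibleChart [ChartedSpace F X] [IsManifold 𝓘(ℝ, F) ∞ X] {ι : X → E}
    (h : ∀ e ∈ atlas F X, IsCompatibleChart ι e) : ContMDiff 𝓘(ℝ, F) 𝓘(ℝ, E) ∞ ι := by
  intro x
  have h1 := (h _ (chart_mem_atlas F x)).1.contDiffAt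
    ((chartAt F x).open_target.mem_nhds (mem_chart_target F x))
  have h2 : ContMDiffAt 𝓘(ℝ, F) 𝓘(ℝ, F) ∞ (chartAt F x) x :=
    contMDiffOn_chart.contMDiffAt (chart_source_mem_nhds F x)
  refine (h1.contMDiffAt.comp x h2).congr_of_eventuallyEq ?_
  filter_upwards [chart_source_mem_nhds F x] with y hy
  simp [(chartAt F x).left_inv hy]

/-- A map to an embedded manifold is smooth if it is smooth as a map to the ambient space. -/
theorem contMDiffAt_of_comp_isInducing [ChartedSpace F X] [IsManifold 𝓘(ℝ, F) ∞ X] {ι : X → E}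
    (hι : Topology.IsInducing ι) (h : ∀ e ∈ atlas F X, IsCompatibleChart ι e)
    {E' H N : Type*} [NormedAddCommGroup E'] [NormedSpace ℝ E'] [TopologicalSpace H]
    {I : ModelWithCorners ℝ E' H} [TopologicalSpace N] [ChartedSpace H N] {f : N → X} {x : N}
    (hf : ContMDiffAt I 𝓘(ℝ, E) ∞ (fun y => ι (f y)) x) : ContMDiffAt I 𝓘(ℝ, F) ∞ f x := by
  have hcont : ContinuousAt f x := hι.continuousAt_iff.mpr hf.continuousAt
  rw [contMDiffAt_iff_target]
  refine ⟨hcont, ?_⟩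
  obtain ⟨r, hr⟩ := (h _ (chart_mem_atlas F (f x))).2
  refine (r.contDiff.contMDiff.contMDiffAt.comp x hf).congr_of_eventuallyEq ?_
  filter_upwards [hcont (chart_source_mem_nhds F (f x))] with y hy
  simpa using hr _ hy

/-- A map to the units of a normed algebra is smooth if it is smooth as a map to the algebra. -/
theorem contMDiffAt_of_comp_units {R : Type*} [NormedRing R] [NormedAlgebra ℝ R] [CompleteSpace R]
    {E' H N : Type*} [NormedAddCommGroup E'] [NormedSpace ℝ E'] [TopologicalSpace H]
    {I : ModelWithCorners ℝ E' H} [TopologicalSpace N] [ChartedSpace H N] {f : N → Rˣ} {x : N}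
    (hf : ContMDiffAt I 𝓘(ℝ, R) ∞ (fun y => (f y).val) x) : ContMDiffAt I 𝓘(ℝ, R) ∞ f x := by
  rw [contMDiffAt_iff_target]
  exact ⟨Units.isOpenEmbedding_val.isInducing.continuousAt_iff.mpr hf.continuousAt, hf⟩

/-- Translation of a compatible chart by a homeomorphism induced by a linear automorphism. -/
theorem IsCompatibleChart.translate {ι : X → E} {e : OpenPartialHomeomorph X F}
    (he : IsCompatibleChart ι e) (φ : X ≃ₜ X) (L L' : E →L[ℝ] E) (hL : ∀ x, ι (φ x) = L (ι x))
    (hL' : ∀ x, ι (φ.symm x) = L' (ι x)) :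
    IsCompatibleChart ι (φ.transOpenPartialHomeomorph e) := by
  refine ⟨?_, ?_⟩
  · have h1 := L'.contDiff.comp_contDiffOn he.1
    exact h1.congr fun y _ => hL' _
  · obtain ⟨r, hr⟩ := he.2
    refine ⟨r.comp L, fun y hy => ?_⟩
    change e (φ y) = r (L (ι y))
    rw [← hL]
    exact hr (φ y) hy

/-- The derivative of a smooth retraction at a fixed point is a projection. -/
theorem fderiv_comp_self_of_retraction {V : Set E} (hV : IsOpen V) {ρ : E → E} {p : E}
    (hp : p ∈ V) (hρ : ContDiffOn ℝ ∞ ρ V) (hpp : ρ p = p)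
    (hρρ : ∀ y ∈ V, ρ y ∈ V → ρ (ρ y) = ρ y) :
    (fderiv ℝ ρ p).comp (fderiv ℝ ρ p) = fderiv ℝ ρ p := by
  have hd : DifferentiableAt ℝ ρ p :=
    (hρ.contDiffAt (hV.mem_nhds hp)).differentiableAt (by simp)
  have h1 : (ρ ∘ ρ) =ᶠ[nhds p] ρ := by
    have h2 : ρ ⁻¹' V ∈ nhds p := hd.continuousAt (by rw [hpp]; exact hV.mem_nhds hp)
    filter_upwards [hV.mem_nhds hp, h2] with y hy hy2
    exact hρρ y hy hy2
  rw [← hpp] at hd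
  have h3 := fderiv_comp p hd (by rwa [hpp] at hd)
  rw [hpp] at h3
  rw [← h3, h1.fderiv_eq]

/-- If `X`, embedded in `E`, is a smooth retract of an open set near `ι x₀`, then it has a compatible
chart around `x₀`, with values in the image of the derivative of the retraction. With `P` the
derivative of `ρ` at `ι x₀`, the map `P ∘ ρ + (1 - P) ∘ (id - ρ)` is a local diffeomorphism that sends
the image of `X` to the image of `P`. -/
theorem exists_isCompatibleChart_of_retraction [CompleteSpace E] {ι : X → E}
    (hι : Topology.IsInducing ι) (hinj : Function.Injective ι) {V : Set E} (hV : IsOpen V)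
    {ρ : E → E} (hρ : ContDiffOn ℝ ∞ ρ V) (hρX : ∀ y ∈ V, ρ y ∈ Set.range ι)
    (hρι : ∀ x, ι x ∈ V → ρ (ι x) = ι x) (x₀ : X) (hx₀ : ι x₀ ∈ V) :
    ∃ e : OpenPartialHomeomorph X (fderiv ℝ ρ (ι x₀)).toLinearMap.range,
      x₀ ∈ e.source ∧ IsCompatibleChart ι e := by
  set p := ι x₀ with hp
  set P := fderiv ℝ ρ p with hP
  have : Nonempty X := ⟨x₀⟩
  have hρρ : ∀ y ∈ V, ρ y ∈ V → ρ (ρ y) = ρ y := by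
    intro y hy hy2
    obtain ⟨x, hx⟩ := hρX y hy
    rw [← hx]
    exact hρι x (hx ▸ hy2)
  have hPP : ∀ v, P (P v) = P v := fun v =>
    DFunLike.congr_fun (fderiv_comp_self_of_retraction hV hx₀ hρ (hρι x₀ hx₀) hρρ) v
  let f : E → E := fun y => P (ρ y) + ((y - ρ y) - P (y - ρ y))
  have hf : ContDiffOn ℝ ∞ f V :=
    (P.contDiff.comp_contDiffOn hρ).add ((contDiffOn_id.sub hρ).sub
      (P.contDiff.comp_contDiffOn (contDiffOn_id.sub hρ)))
  have hfp : ContDiffAt ℝ ∞ f p := hf.contDiffAt (hV.mem_nhds hx₀)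
  have hPf : ∀ y, P (f y) = P (ρ y) := fun y => by simp [f, hPP]
  have hdf : HasFDerivAt f (ContinuousLinearEquiv.refl ℝ E : E →L[ℝ] E) p := by
    have hd : HasFDerivAt ρ P p :=
      ((hρ.contDiffAt (hV.mem_nhds hx₀)).differentiableAt (by simp)).hasFDerivAt
    have h1 := (P.hasFDerivAt.comp p hd).add (((hasFDerivAt_id p).sub hd).sub
      (P.hasFDerivAt.comp p ((hasFDerivAt_id p).sub hd)))
    have h2 : (ContinuousLinearEquiv.refl ℝ E : E →L[ℝ] E) = P.comp P +
        (ContinuousLinearMap.id ℝ E - P - P.comp (ContinuousLinearMap.id ℝ E - P)) := by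
      ext v
      simp [hPP]
    rw [h2]
    exact h1
  let φ := hfp.toOpenPartialHomeomorph f hdf (by simp)
  have hφ : ∀ y, φ y = f y := fun y => rfl
  -- the part of the domain where `φ` has a smooth inverse, and on which `ρ` stays inside the domain
  let V' : Set E := V ∩ φ.source ∩
    ((V ∩ fderiv ℝ f ⁻¹' Set.range ((↑) : (E ≃L[ℝ] E) → E →L[ℝ] E)) ∩ (V ∩ ρ ⁻¹' (V ∩ φ.source)))
  have hV' : IsOpen V' := by
    refine (hV.inter φ.open_source).inter (IsOpen.inter ?_ ?_)
    · exact (hf.continuousOn_fderiv_of_isOpen hV (by simp)).isOpen_inter_preimage hV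
        ContinuousLinearEquiv.isOpen
    · exact hρ.continuousOn.isOpen_inter_preimage hV (hV.inter φ.open_source)
  let ψ := φ.restrOpen V' hV'
  have hψs : ψ.source = V' := by
    rw [OpenPartialHomeomorph.restrOpen_source]
    exact Set.inter_eq_right.mpr fun y hy => hy.1.2
  have hpV' : p ∈ V' := by
    have hps : p ∈ φ.source := hfp.mem_toOpenPartialHomeomorph_source hdf (by simp)
    refine ⟨⟨hx₀, hps⟩, ⟨hx₀, ?_⟩, hx₀, ?_⟩
    · rw [Set.mem_preimage, hdf.fderiv]
      exact Set.mem_range_self _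
    · rw [Set.mem_preimage, hρι x₀ hx₀]
      exact ⟨hx₀, hps⟩
  have hψsymm : ContDiffOn ℝ ∞ ψ.symm ψ.target := by
    intro w hw
    have hy : ψ.symm w ∈ V' := hψs ▸ ψ.map_target hw
    obtain ⟨L, hL⟩ := hy.2.1.2
    have hfy : ContDiffAt ℝ ∞ f (ψ.symm w) := hf.contDiffAt (hV.mem_nhds hy.1.1)
    refine (ψ.contDiffAt_symm (f₀' := L) hw ?_ hfy).contDiffWithinAt
    rw [hL]
    exact (hfy.differentiableAt (by simp)).hasFDerivAt
  have hψι : ∀ x, ι x ∈ V' → f (ι x) = P (ι x) := by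
    intro x hx
    simp [f, hρι x hx.1.1]
  -- points of the domain that `φ` sends to the image of `P` are fixed by `ρ`
  have hfix : ∀ w ∈ ψ.target, P w = w → ∃ x, ι x = ψ.symm w := by
    intro w hw hPw
    have hy : ψ.symm w ∈ V' := hψs ▸ ψ.map_target hw
    have hfy : f (ψ.symm w) = w := ψ.right_inv hw
    have h1 : ρ (ψ.symm w) = ψ.symm w := by
      refine φ.injOn hy.2.2.2.2 hy.1.2 ?_
      change f (ρ (ψ.symm w)) = f (ψ.symm w)
      have h2 : f (ρ (ψ.symm w)) = P (ρ (ψ.symm w)) := by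
        simp [f, hρρ _ hy.1.1 hy.2.2.2.1]
      rw [h2, ← hPf, hfy, hPw]
    rw [← h1]
    exact hρX _ hy.1.1
  have hWP : ∀ w : P.toLinearMap.range, P w = w := by
    rintro ⟨_, v, rfl⟩
    exact hPP v
  have hinv : ∀ w : P.toLinearMap.range, (w : E) ∈ ψ.target →
      ι (Function.invFun ι (ψ.symm w)) = ψ.symm w := fun w hw =>
    Function.invFun_eq (hfix w hw (hWP w))
  let r : E →L[ℝ] P.toLinearMap.range := P.codRestrict _ fun v => ⟨v, rfl⟩
  have hsub : ContDiff ℝ ∞ ((↑) : P.toLinearMap.range → E) := P.toLinearMap.range.subtypeL.contDiff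
  have hcd : ContDiffOn ℝ ∞ (ι ∘ fun w : P.toLinearMap.range => Function.invFun ι (ψ.symm w))
      ((↑) ⁻¹' ψ.target) :=
    (hψsymm.comp hsub.contDiffOn fun w hw => hw).congr fun w hw => hinv w hw
  let e : OpenPartialHomeomorph X P.toLinearMap.range :=
    { toFun := fun x => r (ι x)
      invFun := fun w => Function.invFun ι (ψ.symm w)
      source := ι ⁻¹' V'
      target := (↑) ⁻¹' ψ.target
      map_source' := fun x hx => by
        change P (ι x) ∈ ψ.target
        rw [← hψι x hx]
        exact ψ.map_source (hψs.symm ▸ hx)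
      map_target' := fun w hw => by
        change ι (Function.invFun ι (ψ.symm w)) ∈ V'
        rw [hinv w hw]
        exact hψs ▸ ψ.map_target hw
      left_inv' := fun x hx => by
        change Function.invFun ι (ψ.symm (P (ι x))) = x
        rw [← hψι x hx]
        have : ψ.symm (f (ι x)) = ι x := ψ.left_inv (hψs.symm ▸ hx)
        rw [this]
        exact Function.leftInverse_invFun hinj x
      right_inv' := fun w hw => by
        ext1
        change P (ι (Function.invFun ι (ψ.symm w))) = w
        have h1 : ι (Function.invFun ι (ψ.symm w)) ∈ V' := by
          rw [hinv w hw]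
          exact hψs ▸ ψ.map_target hw
        rw [← hψι _ h1, hinv w hw]
        exact ψ.right_inv hw
      open_source := hV'.preimage hι.continuous
      open_target := ψ.open_target.preimage continuous_subtype_val
      continuousOn_toFun := (r.continuous.comp hι.continuous).continuousOn
      continuousOn_invFun := hι.continuousOn_iff.mpr hcd.continuousOn }
  exact ⟨e, hpV', hcd, r, fun y _ => rfl⟩

/-- Compatible charts stay compatible under linear changes of coordinates. -/
theorem IsCompatibleChart.trans_continuousLinearEquiv {F' : Type*} [NormedAddCommGroup F']
    [NormedSpace ℝ F'] {ι : X → E} {e : OpenPartialHomeomorph X F} (he : IsCompatibleChart ι e)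
    (L : F ≃L[ℝ] F') :
    IsCompatibleChart ι (e.transHomeomorph L.toHomeomorph) := by
  refine ⟨?_, ?_⟩
  · exact he.1.comp L.symm.contDiff.contDiffOn fun w hw => hw
  · obtain ⟨r, hr⟩ := he.2
    exact ⟨(L : F →L[ℝ] F').comp r, fun y hy => congrArg L (hr y hy)⟩

end charts

end

section

variable {d : ℕ} {n : Fin d → ℕ}

/-! ### Orbits with smooth local sections -/

/-- The action of a group element as a continuous linear map. -/
noncomputable def smulCLM (g : GLProd n) : Tensor n →L[ℝ] Tensor n :=
  LinearMap.toContinuousLinearMap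
    { toFun := fun T => g • T
      map_add' := fun T T' => by
        funext k
        simp only [smul_eq_matAct, matAct, Pi.add_apply, mul_add, Finset.sum_add_distrib]
      map_smul' := fun c T => by
        funext k
        simp only [smul_eq_matAct, matAct, Pi.smul_apply, smul_eq_mul, Finset.mul_sum,
          RingHom.id_apply]
        exact Finset.sum_congr rfl fun l _ => by ring }

theorem smulCLM_apply (g : GLProd n) (T : Tensor n) : smulCLM g T = g • T := rfl

/-- A smooth section of the orbit map of `T₀` on an open set `V` of tensors. -/
structure IsLocalSection (T₀ : Tensor n) (V : Set (Tensor n)) (τ : Tensor n → GLProd n) :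
    Prop where
  isOpen : IsOpen V
  contDiffOn : ContDiffOn ℝ ∞ (fun T => (τ T).val) V
  smul_eq : ∀ T ∈ V, T ∈ MulAction.orbit (GLProd n) T₀ → τ T • T₀ = T

namespace IsLocalSection

variable {T₀ : Tensor n} {V : Set (Tensor n)} {τ : Tensor n → GLProd n}

theorem translate (hτ : IsLocalSection T₀ V τ) (g : GLProd n) :
    IsLocalSection T₀ (smulCLM g⁻¹ ⁻¹' V) (fun T => g * τ (g⁻¹ • T)) where
  isOpen := hτ.isOpen.preimage (smulCLM g⁻¹).continuous
  contDiffOn := contDiffOn_const.mul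
    (hτ.contDiffOn.comp (smulCLM g⁻¹).contDiff.contDiffOn fun _ hT => hT)
  smul_eq := fun T hT hTo => by
    have h1 := hτ.smul_eq (g⁻¹ • T) hT (MulAction.mem_orbit_of_mem_orbit g⁻¹ hTo)
    rw [mul_smul, h1, smul_inv_smul]

theorem contMDiffAt (hτ : IsLocalSection T₀ V τ) {T : Tensor n} (hT : T ∈ V) :
    ContMDiffAt 𝓘(ℝ, Tensor n) 𝓘(ℝ, MatProd n) ∞ τ T :=
  contMDiffAt_of_comp_units
    (hτ.contDiffOn.contDiffAt (hτ.isOpen.mem_nhds hT)).contMDiffAt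

theorem continuousAt (hτ : IsLocalSection T₀ V τ) {T : Tensor n} (hT : T ∈ V) :
    ContinuousAt τ T :=
  (hτ.contMDiffAt hT).continuousAt

/-- A section of the orbit map provides representatives of cosets. -/
theorem mk_apply (hτ : IsLocalSection T₀ V τ) {y : GLProd n ⧸ MulAction.stabilizer (GLProd n) T₀}
    (hy : MulAction.ofQuotientStabilizer (GLProd n) T₀ y ∈ V) :
    (τ (MulAction.ofQuotientStabilizer (GLProd n) T₀ y) :
      GLProd n ⧸ MulAction.stabilizer (GLProd n) T₀) = y := by
  apply MulAction.injective_ofQuotientStabilizer (GLProd n) T₀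
  rw [MulAction.ofQuotientStabilizer_mk]
  exact hτ.smul_eq _ hy (MulAction.ofQuotientStabilizer_mem_orbit (GLProd n) T₀ y)

/-- The orbit is a smooth retract of an open set of tensors. -/
theorem contDiffOn_retraction (hτ : IsLocalSection T₀ V τ) :
    ContDiffOn ℝ ∞ (fun T => τ T • T₀) V :=
  contDiff_matAct.comp_contDiffOn (hτ.contDiffOn.prodMk contDiffOn_const)

/-- A homogeneous space that is embedded equivariantly in the space of tensors, with image the orbit
of `T₀`, has compatible charts around all points. -/
theorem exists_charts (hτ : IsLocalSection T₀ V τ) (hV : T₀ ∈ V) {X : Type*} [TopologicalSpace X]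
    [MulAction (GLProd n) X] [ContinuousConstSMul (GLProd n) X]
    [MulAction.IsPretransitive (GLProd n) X]
    {ι : X → Tensor n} (hι : Topology.IsInducing ι) (hinj : Function.Injective ι)
    (hsmul : ∀ (g : GLProd n) x, ι (g • x) = g • ι x) (x₀ : X) (hx₀ : ι x₀ = T₀) :
    ∃ e : X → OpenPartialHomeomorph X (EuclideanSpace ℝ
      (Fin (Module.finrank ℝ (fderiv ℝ (fun T => τ T • T₀) T₀).toLinearMap.range))),
      (∀ x, x ∈ (e x).source) ∧ ∀ x, IsCompatibleChart ι (e x) := by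
  obtain ⟨e₀, he₀, hcomp⟩ := exists_isCompatibleChart_of_retraction hι hinj hτ.isOpen
    hτ.contDiffOn_retraction (fun T _ => ⟨τ T • x₀, by rw [hsmul, hx₀]⟩)
    (fun x hx => hτ.smul_eq _ hx (by
      obtain ⟨g, rfl⟩ := MulAction.exists_smul_eq (GLProd n) x₀ x
      exact ⟨g, by rw [hsmul, hx₀]⟩)) x₀ (hx₀.symm ▸ hV)
  subst hx₀
  let L := ContinuousLinearEquiv.ofFinrankEq (𝕜 := ℝ)
    (E := (fderiv ℝ (fun T => τ T • ι x₀) (ι x₀)).toLinearMap.range)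
    (F := EuclideanSpace ℝ
      (Fin (Module.finrank ℝ (fderiv ℝ (fun T => τ T • ι x₀) (ι x₀)).toLinearMap.range)))
    (by simp)
  choose g hg using fun x => MulAction.exists_smul_eq (GLProd n) x x₀
  refine ⟨fun x => (Homeomorph.smul (g x)).transOpenPartialHomeomorph
    (e₀.transHomeomorph L.toHomeomorph), fun x => ?_, fun x => ?_⟩
  · change g x • x ∈ e₀.source
    rwa [hg]
  · exact (hcomp.trans_continuousLinearEquiv L).translate _ (smulCLM (g x)) (smulCLM (g x)⁻¹)
      (fun y => hsmul _ _) (fun y => hsmul _ _)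

/-- In the presence of local sections, `G / H` is embedded in the space of tensors. -/
theorem isInducing_ofQuotientStabilizer (hτ : IsLocalSection T₀ V τ) (hV : T₀ ∈ V) :
    Topology.IsInducing (MulAction.ofQuotientStabilizer (GLProd n) T₀) := by
  have hcont : Continuous (MulAction.ofQuotientStabilizer (GLProd n) T₀) := by
    refine (QuotientGroup.isQuotientMap_mk _).continuous_iff.mpr ?_
    exact contDiff_matAct.continuous.comp (Units.continuous_val.prodMk continuous_const)
  rw [Topology.isInducing_iff_nhds]
  intro x
  refine le_antisymm hcont.continuousAt.le_comap ?_
  obtain ⟨g, rfl⟩ := QuotientGroup.mk_surjective x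
  have hg : g • T₀ ∈ smulCLM g⁻¹ ⁻¹' V := by
    rwa [Set.mem_preimage, smulCLM_apply, inv_smul_smul]
  have hsec := hτ.translate g
  have hc : ContinuousAt (fun T => ((g * τ (g⁻¹ • T) : GLProd n) :
      GLProd n ⧸ MulAction.stabilizer (GLProd n) T₀)) (g • T₀) :=
    QuotientGroup.continuous_mk.continuousAt.comp (hsec.continuousAt hg)
  intro U hU
  have hU2 : U ∈ nhds ((g * τ (g⁻¹ • (g • T₀)) : GLProd n) :
      GLProd n ⧸ MulAction.stabilizer (GLProd n) T₀) := by
    have h1 := hsec.mk_apply (y := (g : GLProd n ⧸ MulAction.stabilizer (GLProd n) T₀)) hg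
    rw [MulAction.ofQuotientStabilizer_mk] at h1
    rwa [h1]
  refine Filter.mem_comap.mpr ⟨_, Filter.inter_mem (hc hU2) (hsec.isOpen.mem_nhds hg), ?_⟩
  rintro y ⟨hy1, hy2⟩
  rw [← hsec.mk_apply hy2]
  exact hy1

/-- The orbit of a tensor near which the orbit map has a smooth section is the smooth homogeneous
manifold `G / H`. Both spaces carry the charts induced from the space of tensors; smoothness of maps
into them is tested in the space of tensors, and smoothness of maps out of `G / H` is tested with the
local sections. -/
theorem orbitIsSmoothHomogeneous (hτ : IsLocalSection T₀ V τ) (hV : T₀ ∈ V) (hτ1 : τ T₀ = 1) :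
    OrbitIsSmoothHomogeneous T₀ := by
  have : ContinuousConstSMul (GLProd n) (Tensor n) := ⟨fun g => (smulCLM g).continuous⟩
  have : ContinuousConstSMul (GLProd n) (MulAction.orbit (GLProd n) T₀) :=
    ⟨fun g => ((continuous_const_smul g).comp continuous_subtype_val).subtype_mk _⟩
  set ιQ := MulAction.ofQuotientStabilizer (GLProd n) T₀ with hιQ
  let ιO : MulAction.orbit (GLProd n) T₀ → Tensor n := Subtype.val
  have hQ : Topology.IsInducing ιQ := hτ.isInducing_ofQuotientStabilizer hV
  have hO : Topology.IsInducing ιO := Topology.IsInducing.subtypeVal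
  obtain ⟨eQ, heQ, hcQ⟩ := hτ.exists_charts hV hQ
    (MulAction.injective_ofQuotientStabilizer (GLProd n) T₀)
    (MulAction.ofQuotientStabilizer_smul (GLProd n) T₀) ((1 : GLProd n) : GLProd n ⧸ _)
    (by rw [hιQ, MulAction.ofQuotientStabilizer_mk, one_smul])
  obtain ⟨eO, heO, hcO⟩ := hτ.exists_charts hV hO Subtype.val_injective (fun _ _ => rfl)
    ⟨T₀, MulAction.mem_orbit_self T₀⟩ rfl
  -- the common dimension is the rank of the derivative of the retraction at `T₀`
  generalize Module.finrank ℝ (fderiv ℝ (fun T => τ T • T₀) T₀).toLinearMap.range = k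
    at eQ eO
  let cQ := chartedSpaceOfCharts eQ heQ
  let cO := chartedSpaceOfCharts eO heO
  have haQ : ∀ e ∈ atlas (EuclideanSpace ℝ (Fin k))
      (GLProd n ⧸ MulAction.stabilizer (GLProd n) T₀), IsCompatibleChart ιQ e := by
    rintro _ ⟨x, rfl⟩
    exact hcQ x
  have haO : ∀ e ∈ atlas (EuclideanSpace ℝ (Fin k)) (MulAction.orbit (GLProd n) T₀),
      IsCompatibleChart ιO e := by
    rintro _ ⟨x, rfl⟩
    exact hcO x
  have mQ := isManifold_of_isCompatibleChart haQ
  have mO := isManifold_of_isCompatibleChart haO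
  have sQ := contMDiff_of_isCompatibleChart haQ
  have sO := contMDiff_of_isCompatibleChart haO
  have hact : ContMDiff (𝓘(ℝ, MatProd n).prod 𝓘(ℝ, Tensor n)) 𝓘(ℝ, Tensor n) ∞
      fun q : GLProd n × Tensor n => q.1 • q.2 :=
    contDiff_matAct.contMDiff.comp
      ((Units.contMDiff_val.comp contMDiff_fst).prodMk_space contMDiff_snd)
  have hπ : ContMDiff 𝓘(ℝ, MatProd n) (𝓡 k) ∞
      (fun g : GLProd n => (g : GLProd n ⧸ MulAction.stabilizer (GLProd n) T₀)) := fun g =>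
    contMDiffAt_of_comp_isInducing hQ haQ
      (hact.comp (contMDiff_id.prodMk contMDiff_const)).contMDiffAt
  have hsec : ∀ g : GLProd n, ∃ σ : GLProd n ⧸ MulAction.stabilizer (GLProd n) T₀ → GLProd n,
      ContMDiffAt (𝓡 k) 𝓘(ℝ, MatProd n) ∞ σ g ∧ σ g = g ∧ ∀ᶠ y in nhds
        (g : GLProd n ⧸ MulAction.stabilizer (GLProd n) T₀), (σ y : GLProd n ⧸ _) = y := by
    intro g
    have hg : ιQ g ∈ smulCLM g⁻¹ ⁻¹' V := by
      rwa [hιQ, MulAction.ofQuotientStabilizer_mk, Set.mem_preimage, smulCLM_apply,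
        inv_smul_smul]
    refine ⟨fun y => g * τ (g⁻¹ • ιQ y), ((hτ.translate g).contMDiffAt hg).comp _ (sQ _), ?_, ?_⟩
    · simp only [hιQ, MulAction.ofQuotientStabilizer_mk, inv_smul_smul, hτ1, mul_one]
    · filter_upwards [hQ.continuous.continuousAt ((hτ.translate g).isOpen.mem_nhds hg)] with y hy
      exact (hτ.translate g).mk_apply hy
  let Φ : (GLProd n ⧸ MulAction.stabilizer (GLProd n) T₀) ≃ MulAction.orbit (GLProd n) T₀ :=
    (MulAction.orbitEquivQuotientStabilizer (GLProd n) T₀).symm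
  have hΦ : ∀ y, ιO (Φ y) = ιQ y := fun y => rfl
  refine ⟨k, cQ, cO, mQ, mO, hπ, fun g => ?_, fun f => ⟨fun hf => hf.comp hπ, fun hf y => ?_⟩, ?_,
    ⟨Φ, ?_, ?_⟩, fun g => rfl⟩
  · obtain ⟨σ, hσ, hσg, hσπ⟩ := hsec g
    have h1 : MDifferentiableAt 𝓘(ℝ, MatProd n) (𝓡 k)
        (fun g : GLProd n => (g : GLProd n ⧸ MulAction.stabilizer (GLProd n) T₀)) (σ g) :=
      (hπ _).mdifferentiableAt (by simp)
    have h2 := mfderiv_comp _ h1 (hσ.mdifferentiableAt (by simp))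
    have h3 : mfderiv (𝓡 k) (𝓡 k) (fun y => (σ y : GLProd n ⧸ MulAction.stabilizer (GLProd n) T₀))
        (g : GLProd n ⧸ MulAction.stabilizer (GLProd n) T₀) = ContinuousLinearMap.id ℝ _ := by
      rw [Filter.EventuallyEq.mfderiv_eq (f := id) hσπ, mfderiv_id]
    have h4 : Function.Surjective (mfderiv 𝓘(ℝ, MatProd n) (𝓡 k)
        (fun g : GLProd n => (g : GLProd n ⧸ MulAction.stabilizer (GLProd n) T₀))
        (σ (g : GLProd n ⧸ MulAction.stabilizer (GLProd n) T₀))) := fun v =>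
      ⟨_, DFunLike.congr_fun (h2.symm.trans h3) v⟩
    rwa [hσg] at h4
  · obtain ⟨g, rfl⟩ := QuotientGroup.mk_surjective y
    obtain ⟨σ, hσ, -, hσπ⟩ := hsec g
    refine ((hf (σ g)).comp _ hσ).congr_of_eventuallyEq ?_
    filter_upwards [hσπ] with y hy
    exact congrArg f hy.symm
  · exact fun q => contMDiffAt_of_comp_isInducing hO haO
      (hact.comp (contMDiff_fst.prodMk (sO.comp contMDiff_snd))).contMDiffAt
  · exact fun y => contMDiffAt_of_comp_isInducing hO haO (sQ y)
  · refine fun y => contMDiffAt_of_comp_isInducing hQ haQ ?_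
    have h1 : (fun y => ιQ (Φ.symm y)) = ιO := funext fun y => by
      rw [← hΦ, Equiv.apply_symm_apply]
    have h2 := sO y
    rw [← h1] at h2
    exact h2

end IsLocalSection

end

end TensorTrain

theorem mainTheorem2 (d : ℕ) (hd : 3 ≤ d) (n : Fin d → ℕ) (hn : ∀ i, 2 ≤ n i)
    (s : Fin (d + 1) → ℕ) (hs0 : s 0 = 1) (hsd : s (Fin.last d) = 1) (hs : ∀ j, 1 ≤ s j)
    (h : ∀ i : Fin d, s i.castSucc * s i.succ ≤ n i) :
    (∀ (g : TensorTrain.GLProd n), ∀ T ∈ TensorTrain.ttRankSet n s,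
      g • T ∈ TensorTrain.ttRankSet n s) ∧
    (∀ T ∈ TensorTrain.ttRankSet n s, ∀ i : Fin d,
      TensorTrain.multilinearRank T i ≤ s i.castSucc * s i.succ) ∧
    TensorTrain.ttManifold n s =
      MulAction.orbit (TensorTrain.GLProd n) (TensorTrain.baseTensor h) ∧
    IsOpen {T : TensorTrain.ttRankSet n s | (T : TensorTrain.Tensor n) ∈ TensorTrain.ttManifold n s} ∧
    Dense {T : TensorTrain.ttRankSet n s | (T : TensorTrain.Tensor n) ∈ TensorTrain.ttManifold n s} ∧
    TensorTrain.IsZariskiOpenInClosure (TensorTrain.ttRankSet n s) (TensorTrain.ttManifold n s) ∧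
    TensorTrain.OrbitIsSmoothHomogeneous (TensorTrain.baseTensor h) ∧
    (∀ g : TensorTrain.GLProd n,
      g ∈ MulAction.stabilizer (TensorTrain.GLProd n) (TensorTrain.baseTensor h) ↔
        TensorTrain.IsStabilizerForm h g.val) := by
  have hd2 : 2 ≤ d := by omega
  have k₀ : TensorTrain.Index n := TensorTrain.pathIndex h fun l => ⟨0, hs l⟩
  obtain ⟨V, τ, hV, hT₀, hτ, hτ1, hsec⟩ := TensorTrain.exists_smooth_section h hs hd2 hs0 hsd
  exact ⟨fun g T hT => TensorTrain.smul_mem_ttRankSet g hT,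
    fun T hT => TensorTrain.multilinearRank_le k₀ hd2 hs0 hsd hs hT,
    TensorTrain.ttManifold_eq_orbit h hd2 hs0 hsd hs,
    TensorTrain.isOpen_ttManifold k₀ hd2 hs0 hsd hs,
    TensorTrain.dense_ttManifold h hd2 hs0 hsd hs,
    TensorTrain.isZariskiOpenInClosure_ttManifold k₀ hd2 hs0 hsd hs,
    TensorTrain.IsLocalSection.orbitIsSmoothHomogeneous ⟨hV, hτ, hsec⟩ hT₀ hτ1,
    TensorTrain.mem_stabilizer_iff_isStabilizerForm h hs hs0 hsd⟩
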